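/- Let $N$ be a $II_1$ factor, $G$ a group and $\chi:G\to \mathrm{Out}(N)$ an injective homomorphism (a $G$-kernel). Choose a lift $\alpha:G\to\mathrm{Aut}(N)$ of $\chi$ with $\alpha_e=\mathrm{id}$, and unitaries $u(g,h)\in N$ with $\alpha_g\alpha_h=\mathrm{Ad}_{u(g,h)}\,\alpha_{gh}$ and $u(g,e)=1=u(e,g)$. Let $\omega:G^3\to S^1$ be the associated normalized $3$-cocycle (the obstruction), determined by $$u(g_1,g_2)\,u(g_1g_2,g_3)=\omega(g_1,g_2,g_3)\,\alpha_{g_1}(u(g_2,g_3))\,u(g_1,g_2g_3).$$ For $g\in G$ let $X_g$ be the Hilbert $N$-$N$-bimodule $L^2(N)$ with left action $x\cdot\xi=x\xi$ and right action $\xi\cdot x=\xi\,\alpha_g(x)$; if $G$ is finitely generated, then for the associated diagonal subfactor $N\subset M_I(N)$, $x\mapsto\mathrm{diag}(\alpha_i(x))_{i\in I}$, with $I\ni e$ a finite generating set of $G$, these are, up to isomorphism, the irreducible $N$-$N$-bimodules of the subfactor. For $x\in N$ write $[x]_g$ for $x$ seen as a vector of $X_g$. Let $\mathcal T^s_{g_1,g_2}$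 be the space of bounded bimodule maps $X_{g_1}\otimes_N X_s\to X_s\otimes_N X_{g_2}$. The tube algebra is the algebraic direct sum $\mathcal T=\bigoplus_{g_1,g_2,s\in G}\mathcal T^s_{g_1,g_2}$. For $a\in\mathcal T^s_{g_1,g_2}$ and $b\in\mathcal T^t_{g_2,g_3}$ the product $b\cdot a\in\mathcal T^{st}_{g_1,g_3}$ and the involution $a^\#\in\mathcal T^{s^{-1}}_{g_2,g_1}$ are $$b\cdot a=(\beta_{s,t}\otimes \mathrm{id}_{X_{g_3}})(\mathrm{id}_{X_s}\otimes b)(a\otimes\mathrm{id}_{X_t})(\mathrm{id}_{X_{g_1}}\otimes\beta_{s,t}^*),$$ $$a^\#=(\mathrm{id}_{X_{s^{-1}}}\otimes\mathrm{id}_{X_{g_1}}\otimes \overline R_s^{\,*})(\mathrm{id}_{X_{s^{-1}}}\otimes a^*\otimes\mathrm{id}_{X_{s^{-1}}})(R_s\otimes\mathrm{id}_{X_{g_2}}\otimes\mathrm{id}_{X_{s^{-1}}}),$$ where $\beta_{s,t}:X_s\otimes_N X_t\to X_{st}$ is the bimodule map $[1]_s\otimes[1]_t\mapsto[u(s,t)]_{st}$,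 $R_s=\beta^*_{s^{-1},s}$ and $\overline R_s=\omega(s,s^{-1},s)\,\beta^*_{s,s^{-1}}$. The product of $\mathcal T^t_{g_2',g_3}$ and $\mathcal T^s_{g_1,g_2}$ is $0$ if $g_2\neq g_2'$. For each conjugacy class $C$ of $G$ fix $g_C\in C$, let $G_C$ be the centralizer of $g_C$, and let $\varphi_C$ be the normalized $2$-cocycle $\varphi_C(s,t)=\overline{\varphi_{g_C}(t^{-1},s^{-1})}$ on $G_C$, where $\varphi_a(g,h)=\overline{\omega(a,g,h)}\,\omega(g,a,h)\,\overline{\omega(g,h,a)}$. Let $[\mathbb CG_C]_{\varphi_C}$ be the twisted group $*$-algebra, with basis $[s]$, $s\in G_C$, $[s][t]=\varphi_C(s,t)[st]$ and $[s]^*=[s]^{-1}$, and let $M_C$ be the $*$-algebra of finitely supported complex matrices with rows and columns indexed by $C$. A representation of a $*$-algebra means a nondegenerate $*$-homomorphism into the bounded operators on a Hilbert space; a submodule is a closed invariant subspace; morphisms of representations are bounded intertwiners. **Theorem.** (i) $\mathcal T$ is isomorphic to $\bigoplus_C M_C\otimes[\mathbb CG_C]_{\varphi_C}$ as a $*$-algebra,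 the sum being over all conjugacy classes $C$ of $G$. (ii) For $g\in G$ let $a(g,e,g)\in\mathcal T^e_{g,g}$ be the projection $[1]_g\otimes[1]_e\mapsto[1]_e\otimes[1]_g$. For every representation $\Pi$ of $\mathcal T$ on a Hilbert space $V$, let $V^C$ be the submodule generated by the range of $\Pi(a(g_C,e,g_C))$ (the $g_C$-th space of $V$). Then $V$ is the orthogonal direct sum of the $V^C$. This decomposition is unique: call a representation of $\mathcal T$ supported on $C$ if it is generated by its vectors in the $g_C$-th space; if $V$ is the orthogonal direct sum of submodules $W^C$, with $W^C$ supported on $C$, then $W^C=V^C$ for all $C$. For every $C$, the category of $C$-supported representations of $\mathcal T$ is equivalent, by a $\mathbb C$-linear (in particular additive) functor, to the category of representations of $[\mathbb CG_C]_{\varphi_C}$. -/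

import Mathlib

open scoped InnerProductSpace TensorProduct DirectSum
open CategoryTheory

/-! ## II₁ factors in standard form -/

/-- A II₁ factor `N` in standard form: an infinite dimensional von Neumann algebra with trivial
centre acting on `H = L²(N)`, where `Ω` is the class of `1`, that is, a cyclic unit vector whose
vector state is the trace (faithful and normal, as `Ω` is then also separating).  The left action of `N` on `L²(N)` is the given action on `H`. -/
structure II1Factor (H : Type*) [NormedAddCommGroup H] [InnerProductSpace ℂ H]
    [CompleteSpace H] where
  N : VonNeumannAlgebra H
  Ω : H
  norm_Ω : ‖Ω‖ = 1
  cyclic : Dense {ξ : H | ∃ x ∈ N, x Ω = ξ}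
  tracial : ∀ x ∈ N, ∀ y ∈ N, ⟪Ω, x (y Ω)⟫_ℂ = ⟪Ω, y (x Ω)⟫_ℂ
  factor : ∀ z ∈ N, (∀ x ∈ N, z * x = x * z) → ∃ c : ℂ, z = c • (1 : H →L[ℂ] H)
  infinite_dimensional : ¬ FiniteDimensional ℂ N.toStarSubalgebra

/-- If `S` is a star algebra of operators, `S Ω` is dense and `‖x* Ω‖ = ‖x Ω‖` on `S`, then right
multiplication by `v ∈ S` is a bounded operator. -/
theorem exists_rightMul {H : Type*} [NormedAddCommGroup H] [InnerProductSpace ℂ H]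
    [CompleteSpace H] (S : StarSubalgebra ℂ (H →L[ℂ] H)) (Ω : H)
    (hd : Dense {ξ : H | ∃ x ∈ S, x Ω = ξ}) (hs : ∀ x ∈ S, ‖(star x) Ω‖ = ‖x Ω‖)
    (v : H →L[ℂ] H) (hv : v ∈ S) : ∃ T : H →L[ℂ] H, ∀ x ∈ S, T (x Ω) = x (v Ω) := by
  let e : S →ₗ[ℂ] H :=
    { toFun := fun x => (x : H →L[ℂ] H) Ω
      map_add' := fun x y => rfl
      map_smul' := fun c x => rfl }
  let f : S →ₗ[ℂ] H :=
    { toFun := fun x => (x : H →L[ℂ] H) (v Ω)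
      map_add' := fun x y => rfl
      map_smul' := fun c x => rfl }
  have he : DenseRange e := by
    refine hd.mono ?_
    rintro ξ ⟨x, hx, rfl⟩
    exact ⟨⟨x, hx⟩, rfl⟩
  have hf : ∀ x : S, ‖f x‖ ≤ ‖v‖ * ‖e x‖ := by
    intro x
    have h1 := hs (x * v) (mul_mem x.2 hv)
    have h2 : ‖(star v) ((star (x : H →L[ℂ] H)) Ω)‖ ≤ ‖star v‖ * ‖(star (x : H →L[ℂ] H)) Ω‖ :=
      ContinuousLinearMap.le_opNorm _ _
    rw [norm_star, hs x x.2] at h2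
    rw [star_mul] at h1
    change ‖(x : H →L[ℂ] H) (v Ω)‖ ≤ _
    change ‖(star v) ((star (x : H →L[ℂ] H)) Ω)‖ = ‖(x : H →L[ℂ] H) (v Ω)‖ at h1
    rw [← h1]
    exact h2
  refine ⟨f.extendOfNorm e, fun x hx => ?_⟩
  exact LinearMap.extendOfNorm_eq he ⟨‖v‖, hf⟩ ⟨x, hx⟩

/-- Two operators agreeing on a dense set `{x Ω}` are equal. -/
theorem eq_of_eq_on_cyclic {H : Type*} [NormedAddCommGroup H] [InnerProductSpace ℂ H]
    {S : Set (H →L[ℂ] H)} {Ω : H} (hd : Dense {ξ : H | ∃ x ∈ S, x Ω = ξ}) {T T' : H →L[ℂ] H}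
    (h : ∀ x ∈ S, T (x Ω) = T' (x Ω)) : T = T' := by
  refine ContinuousLinearMap.ext fun ξ => ?_
  refine congrFun (Continuous.ext_on hd T.continuous T'.continuous ?_) ξ
  rintro _ ⟨x, hx, rfl⟩
  exact h x hx

namespace II1Factor

variable {H : Type*} [NormedAddCommGroup H] [InnerProductSpace ℂ H] [CompleteSpace H]
  (M : II1Factor H)

/-- The elements of the factor, as a unital star algebra. -/
abbrev Elt : Type _ := M.N.toStarSubalgebra

/-- The group `Aut(N)` of star automorphisms. -/
abbrev Aut : Type _ := M.Elt ≃⋆ₐ[ℂ] M.Elt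

/-- The bounded vector `[x] ∈ L²(N)` of `x ∈ N`. -/
def vec (x : M.Elt) : H := (x : H →L[ℂ] H) M.Ω

theorem norm_star_apply (x : H →L[ℂ] H) (hx : x ∈ M.N) : ‖(star x) M.Ω‖ = ‖x M.Ω‖ := by
  have h := M.tracial x hx (star x) (star_mem hx)
  have h1 : ⟪(star x) M.Ω, (star x) M.Ω⟫_ℂ = ⟪x M.Ω, x M.Ω⟫_ℂ := by
    rw [ContinuousLinearMap.star_eq_adjoint] at h ⊢
    rw [ContinuousLinearMap.adjoint_inner_left, h, ContinuousLinearMap.adjoint_inner_right]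
  rw [inner_self_eq_norm_sq_to_K, inner_self_eq_norm_sq_to_K] at h1
  have h2 : ‖(star x) M.Ω‖ ^ 2 = ‖x M.Ω‖ ^ 2 := by exact_mod_cast h1
  exact (sq_eq_sq₀ (norm_nonneg _) (norm_nonneg _)).1 h2

/-- The right action `ξ ↦ ξ · v` of `v ∈ N` on `L²(N)`, determined by `[x] · v = [x v]`. -/
noncomputable def rightMul (v : M.Elt) : H →L[ℂ] H :=
  (exists_rightMul M.N.toStarSubalgebra M.Ω M.cyclic M.norm_star_apply v v.2).choose

theorem rightMul_vec (v x : M.Elt) : M.rightMul v (M.vec x) = M.vec (x * v) :=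
  (exists_rightMul M.N.toStarSubalgebra M.Ω M.cyclic M.norm_star_apply v v.2).choose_spec x x.2

theorem ext_vec {T T' : H →L[ℂ] H} (h : ∀ x : M.Elt, T (M.vec x) = T' (M.vec x)) : T = T' :=
  eq_of_eq_on_cyclic (S := {x | x ∈ M.N}) M.cyclic fun x hx => h ⟨x, hx⟩

theorem rightMul_mul (v w : M.Elt) : M.rightMul (v * w) = M.rightMul w * M.rightMul v :=
  M.ext_vec fun x => by
    rw [mul_apply_eq_comp, rightMul_vec, rightMul_vec, rightMul_vec, mul_assoc]

theorem rightMul_one : M.rightMul 1 = 1 :=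
  M.ext_vec fun x => by rw [rightMul_vec, mul_one]; rfl

theorem rightMul_add (v w : M.Elt) : M.rightMul (v + w) = M.rightMul v + M.rightMul w :=
  M.ext_vec fun x => by
    rw [add_apply, rightMul_vec, rightMul_vec, rightMul_vec, mul_add]; rfl

theorem rightMul_smul (c : ℂ) (v : M.Elt) : M.rightMul (c • v) = c • M.rightMul v :=
  M.ext_vec fun x => by
    rw [smul_apply, rightMul_vec, rightMul_vec, mul_smul_comm]; rfl

theorem left_vec (x y : M.Elt) : (x : H →L[ℂ] H) (M.vec y) = M.vec (x * y) := rfl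

theorem rightMul_comm (v x : M.Elt) :
    M.rightMul v * (x : H →L[ℂ] H) = (x : H →L[ℂ] H) * M.rightMul v :=
  M.ext_vec fun y => by
    rw [mul_apply_eq_comp, mul_apply_eq_comp, rightMul_vec, left_vec,
      left_vec, rightMul_vec, mul_assoc]

theorem vec_injective : Function.Injective M.vec := by
  intro a b hab
  have h0 : M.vec (a - b) = 0 := by
    have : M.vec (a - b) = M.vec a - M.vec b := rfl
    rw [this, hab, sub_self]
  have h1 : ((a - b : M.Elt) : H →L[ℂ] H) = 0 := by
    refine M.ext_vec fun x => ?_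
    have h2 := M.norm_star_apply _ ((a - b) * x).2
    have h3 := M.norm_star_apply _ (a - b).2
    have h4 : ‖((a - b : M.Elt) : H →L[ℂ] H) M.Ω‖ = 0 := by
      have : ((a - b : M.Elt) : H →L[ℂ] H) M.Ω = 0 := h0
      rw [this, norm_zero]
    rw [h4, norm_eq_zero] at h3
    have h5 : star (((a - b) * x : M.Elt) : H →L[ℂ] H)
        = star (x : H →L[ℂ] H) * star ((a - b : M.Elt) : H →L[ℂ] H) := star_mul _ _
    rw [h5, mul_apply_eq_comp, h3, map_zero, norm_zero] at h2
    exact norm_eq_zero.1 h2.symm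
  have h2 : a - b = 0 := Subtype.ext h1
  exact sub_eq_zero.1 h2

theorem rightMul_Ω (v : M.Elt) : M.rightMul v M.Ω = M.vec v := by
  have h := M.rightMul_vec v 1
  rw [one_mul] at h
  exact h

theorem rightMul_injective : Function.Injective M.rightMul := by
  intro a b hab
  apply M.vec_injective
  rw [← rightMul_Ω, ← rightMul_Ω, hab]

theorem inner_vec (x y : M.Elt) : ⟪M.vec x, M.vec y⟫_ℂ = ⟪M.Ω, M.vec (star x * y)⟫_ℂ := by
  have : M.vec (star x * y) = (star (x : H →L[ℂ] H)) (M.vec y) := rfl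
  rw [this, ContinuousLinearMap.star_eq_adjoint, ContinuousLinearMap.adjoint_inner_right]
  rfl

theorem tracial_vec (x y : M.Elt) : ⟪M.Ω, M.vec (x * y)⟫_ℂ = ⟪M.Ω, M.vec (y * x)⟫_ℂ :=
  M.tracial x x.2 y y.2

theorem rightMul_star (v : M.Elt) : M.rightMul (star v) = star (M.rightMul v) := by
  refine M.ext_vec fun x => ?_
  refine ext_inner_left ℂ fun ξ => ?_
  have hc : Continuous fun ξ : H => ⟪ξ, M.rightMul (star v) (M.vec x)⟫_ℂ := by fun_prop
  have hc' : Continuous fun ξ : H => ⟪ξ, (star (M.rightMul v)) (M.vec x)⟫_ℂ := by fun_prop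
  refine congrFun (Continuous.ext_on M.cyclic hc hc' ?_) ξ
  rintro _ ⟨y, hy, rfl⟩
  change ⟪M.vec ⟨y, hy⟩, _⟫_ℂ = ⟪M.vec ⟨y, hy⟩, _⟫_ℂ
  rw [ContinuousLinearMap.star_eq_adjoint, ContinuousLinearMap.adjoint_inner_right, rightMul_vec,
    rightMul_vec, inner_vec, inner_vec, star_mul, ← mul_assoc, tracial_vec, mul_assoc]

/-- An operator commuting with the left action is right multiplication by an element of `N`. -/
theorem exists_symbol (T : H →L[ℂ] H)
    (hT : ∀ x : M.Elt, T * (x : H →L[ℂ] H) = (x : H →L[ℂ] H) * T) :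
    ∃ v : M.Elt, T = M.rightMul v := by
  have hmem : ∀ S : H →L[ℂ] H, S ∈ M.N.commutant ↔
      ∀ x : M.Elt, S * (x : H →L[ℂ] H) = (x : H →L[ℂ] H) * S := by
    intro S
    rw [VonNeumannAlgebra.mem_commutant_iff]
    exact ⟨fun h x => (h x x.2).symm, fun h x hx => (h ⟨x, hx⟩).symm⟩
  have hR : ∀ v : M.Elt, M.rightMul v ∈ M.N.commutant := fun v =>
    (hmem _).2 fun x => M.rightMul_comm v x
  have hd : Dense {ξ : H | ∃ x ∈ M.N.commutant, x M.Ω = ξ} := by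
    refine M.cyclic.mono ?_
    rintro _ ⟨x, hx, rfl⟩
    exact ⟨M.rightMul ⟨x, hx⟩, hR _, M.rightMul_Ω ⟨x, hx⟩⟩
  have key : ∀ S ∈ M.N.commutant, ∀ y : M.Elt,
      ⟪(star S) M.Ω, M.vec y⟫_ℂ = ⟪M.vec (star y), S M.Ω⟫_ℂ := by
    intro S hS y
    have h1 : S (M.vec y) = (y : H →L[ℂ] H) (S M.Ω) :=
      congrArg (fun U : H →L[ℂ] H => U M.Ω) ((hmem S).1 hS y)
    have h2 : M.vec (star y) = (star (y : H →L[ℂ] H)) M.Ω := rfl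
    rw [ContinuousLinearMap.star_eq_adjoint, ContinuousLinearMap.adjoint_inner_left, h1, h2,
      ContinuousLinearMap.star_eq_adjoint, ContinuousLinearMap.adjoint_inner_left]
  have hle : ∀ S ∈ M.N.commutant, ‖(star S) M.Ω‖ ≤ ‖S M.Ω‖ := by
    intro S hS
    have hb : ∀ ξ : H, ‖⟪(star S) M.Ω, ξ⟫_ℂ‖ ≤ ‖S M.Ω‖ * ‖ξ‖ := by
      intro ξ
      refine M.cyclic.induction (P := fun ξ => ‖⟪(star S) M.Ω, ξ⟫_ℂ‖ ≤ ‖S M.Ω‖ * ‖ξ‖) ?_ ?_ ξ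
      · rintro _ ⟨y, hy, rfl⟩
        have h1 := key S hS ⟨y, hy⟩
        have h2 := norm_inner_le_norm (𝕜 := ℂ) (M.vec (star ⟨y, hy⟩)) (S M.Ω)
        have h3 : ‖M.vec (star ⟨y, hy⟩)‖ = ‖y M.Ω‖ := M.norm_star_apply y hy
        rw [← h1, h3, mul_comm] at h2
        exact h2
      · exact isClosed_le (by fun_prop) (by fun_prop)
    have h1 := hb ((star S) M.Ω)
    rw [inner_self_eq_norm_sq_to_K] at h1
    by_contra hlt
    rw [not_le] at hlt
    have hpos : 0 < ‖(star S) M.Ω‖ := lt_of_le_of_lt (norm_nonneg _) hlt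
    have h2 : ‖(star S) M.Ω‖ ^ 2 ≤ ‖S M.Ω‖ * ‖(star S) M.Ω‖ := by
      simpa using h1
    nlinarith
  have hs : ∀ S ∈ M.N.commutant, ‖(star S) M.Ω‖ = ‖S M.Ω‖ := by
    intro S hS
    refine le_antisymm (hle S hS) ?_
    have h := hle (star S) (star_mem hS)
    rwa [star_star] at h
  obtain ⟨v, hv⟩ := exists_rightMul M.N.commutant.toStarSubalgebra M.Ω hd hs T ((hmem T).2 hT)
  have hvN : v ∈ M.N := by
    rw [← VonNeumannAlgebra.commutant_commutant M.N, VonNeumannAlgebra.mem_commutant_iff]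
    intro S hS
    refine eq_of_eq_on_cyclic (S := {x | x ∈ M.N.commutant}) hd fun R hRm => ?_
    have h1 := hv R hRm
    have h2 := hv (S * R) (mul_mem hS hRm)
    change S (v (R M.Ω)) = v ((S * R) M.Ω)
    rw [h1, h2]
    rfl
  refine ⟨⟨v, hvN⟩, M.ext_vec fun x => ?_⟩
  have h1 := hv 1 (one_mem _)
  have h2 : T (M.vec x) = (x : H →L[ℂ] H) (T M.Ω) :=
    congrArg (fun U : H →L[ℂ] H => U M.Ω) (hT x)
  rw [h2, rightMul_vec]
  change v M.Ω = T M.Ω at h1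
  rw [← h1]
  rfl

/-! ## The bimodules `L²(N_σ)`, `σ ∈ Aut(N)`

The Hilbert `N`-`N`-bimodule `L²(N_σ)` is the Hilbert space `L²(N) = H` with left action
`x · ξ = x ξ` and right action `ξ · x = rightMul (σ x) ξ`; it is recorded by `σ`. -/

/-- The space of bounded `N`-`N`-bimodule maps `L²(N_σ) → L²(N_ρ)`. -/
noncomputable def bimodHom (σ ρ : M.Aut) : Submodule ℂ (H →L[ℂ] H) where
  carrier := {T | (∀ (x : M.Elt) (ξ : H), T ((x : H →L[ℂ] H) ξ) = (x : H →L[ℂ] H) (T ξ)) ∧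
    ∀ (x : M.Elt) (ξ : H), T (M.rightMul (σ x) ξ) = M.rightMul (ρ x) (T ξ)}
  zero_mem' := by simp
  add_mem' := by
    rintro S T ⟨h1, h2⟩ ⟨h3, h4⟩
    exact ⟨fun x ξ => by simp [h1, h3], fun x ξ => by simp [h2, h4]⟩
  smul_mem' := by
    rintro c T ⟨h1, h2⟩
    exact ⟨fun x ξ => by simp [h1], fun x ξ => by simp [h2]⟩

variable {M} {σ σ' σ'' ρ ρ' ρ'' : M.Aut}

theorem exists_symbol_of_bimodHom (T : M.bimodHom σ ρ) : ∃ v : M.Elt, T.1 = M.rightMul v :=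
  M.exists_symbol T.1 fun x => ContinuousLinearMap.ext fun ξ => T.2.1 x ξ

/-- The unique `v ∈ N` for which the bimodule map is `ξ ↦ ξ v`; that is, `[1] ↦ [v]`. -/
noncomputable def symbol (T : M.bimodHom σ ρ) : M.Elt := (exists_symbol_of_bimodHom T).choose

theorem rightMul_symbol (T : M.bimodHom σ ρ) : M.rightMul (symbol T) = T.1 :=
  (exists_symbol_of_bimodHom T).choose_spec.symm

theorem symbol_eq_of {T : M.bimodHom σ ρ} {v : M.Elt} (h : T.1 = M.rightMul v) : symbol T = v :=
  M.rightMul_injective ((rightMul_symbol T).trans h)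

theorem symbol_add (S T : M.bimodHom σ ρ) : symbol (S + T) = symbol S + symbol T :=
  symbol_eq_of (by rw [rightMul_add, rightMul_symbol, rightMul_symbol]; rfl)

theorem apply_vec (T : M.bimodHom σ ρ) (x : M.Elt) : T.1 (M.vec x) = M.vec (x * symbol T) := by
  rw [← rightMul_symbol, rightMul_vec]

variable (M) in
theorem rightMul_mem {v : M.Elt} (hv : ∀ x : M.Elt, σ x * v = v * ρ x) :
    M.rightMul v ∈ M.bimodHom σ ρ := by
  refine ⟨fun x ξ => congrArg (fun U : H →L[ℂ] H => U ξ) (M.rightMul_comm v x), fun x ξ => ?_⟩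
  have h : M.rightMul v * M.rightMul (σ x) = M.rightMul (ρ x) * M.rightMul v := by
    rw [← rightMul_mul, ← rightMul_mul, hv]
  exact congrArg (fun U : H →L[ℂ] H => U ξ) h

theorem symbol_comm (T : M.bimodHom σ ρ) (x : M.Elt) : σ x * symbol T = symbol T * ρ x := by
  apply M.rightMul_injective
  rw [rightMul_mul, rightMul_mul, rightMul_symbol]
  exact ContinuousLinearMap.ext fun ξ => T.2.2 x ξ

/-- The identity of `L²(N_σ)`. -/
noncomputable def idHom (σ : M.Aut) : M.bimodHom σ σ := ⟨1, fun _ _ => rfl, fun _ _ => rfl⟩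

/-- Composition of bimodule maps. -/
noncomputable def compHom (T : M.bimodHom σ' σ'') (S : M.bimodHom σ σ') : M.bimodHom σ σ'' :=
  ⟨T.1 * S.1, fun x ξ => by
      rw [mul_apply_eq_comp, mul_apply_eq_comp, S.2.1, T.2.1],
    fun x ξ => by
      rw [mul_apply_eq_comp, mul_apply_eq_comp, S.2.2, T.2.2]⟩

/-- The Hilbert space adjoint of a bimodule map. -/
noncomputable def adjHom (T : M.bimodHom σ ρ) : M.bimodHom ρ σ :=
  ⟨ContinuousLinearMap.adjoint T.1, by
    rw [← ContinuousLinearMap.star_eq_adjoint, ← rightMul_symbol T, ← rightMul_star]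
    refine rightMul_mem M fun x => ?_
    have h := congrArg star (symbol_comm T (star x))
    rw [star_mul, star_mul, ← map_star, ← map_star, star_star] at h
    exact h.symm⟩

/-- A bimodule map, with its source and target rewritten along equalities in `Aut(N)`. -/
noncomputable def castHom (h : σ = σ') (h' : ρ = ρ') (T : M.bimodHom σ ρ) : M.bimodHom σ' ρ' :=
  ⟨T.1, by subst h h'; exact T.2⟩

/-! The Connes fusion `L²(N_σ) ⊗_N L²(N_ρ)` is `L²(N_{σρ})`: the class of the elementary tensor
`[x]_σ ⊗ [y]_ρ` of bounded vectors is `[x σ(y)]_{σρ}`. This satisfies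
`[x z']_σ ⊗ [y]_ρ = [x]_σ ⊗ [z y]_ρ` for `z' = σ z`, the inner product formula of the
fusion (automorphisms of a II₁ factor preserve its unique trace), and it is strictly associative.
The product `σ * ρ` of `M.Aut` is composition. -/

/-- The elementary tensor `[x]_σ ⊗ [y]_ρ` of bounded vectors, in `L²(N_σ) ⊗_N L²(N_ρ)`. -/
noncomputable def elemTensor (σ : M.Aut) (x y : M.Elt) : H := M.vec (x * σ y)

theorem elemTensor_balanced (σ : M.Aut) (x y z : M.Elt) :
    elemTensor σ (x * σ z) y = elemTensor σ x (z * y) := by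
  unfold elemTensor
  rw [map_mul, mul_assoc]

theorem elemTensor_left (σ : M.Aut) (x y z : M.Elt) :
    (z : H →L[ℂ] H) (elemTensor σ x y) = elemTensor σ (z * x) y := by
  unfold elemTensor
  rw [left_vec, mul_assoc]

theorem elemTensor_right (σ ρ : M.Aut) (x y z : M.Elt) :
    M.rightMul ((σ * ρ) z) (elemTensor σ x y) = elemTensor σ x (y * ρ z) := by
  unfold elemTensor
  rw [rightMul_vec, map_mul, mul_assoc]
  rfl

/-- The inner product of the Connes fusion:
`⟪[x] ⊗ η, [x'] ⊗ η'⟫ = ⟪η, ⟨x, x'⟩_N η'⟫`, where `⟨x, x'⟩_N = σ⁻¹(x* x')` is the `N`-valued inner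
product of bounded vectors of the right module `L²(N_σ)`. -/
theorem inner_elemTensor (σ : M.Aut) (hσ : ∀ x, ⟪M.Ω, M.vec (σ x)⟫_ℂ = ⟪M.Ω, M.vec x⟫_ℂ)
    (x y x' y' : M.Elt) : ⟪elemTensor σ x y, elemTensor σ x' y'⟫_ℂ =
      ⟪M.vec y, M.vec (σ.symm (star x * x') * y')⟫_ℂ := by
  unfold elemTensor
  have h : star (x * σ y) * (x' * σ y') =
      σ (star y * (σ.symm (star x * x') * y')) := by
    rw [map_mul, map_mul, map_star, StarAlgEquiv.apply_symm_apply, star_mul]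
    simp only [mul_assoc]
  rw [inner_vec, inner_vec, h, hσ]

/-- The tensor product `S ⊗_N T : L²(N_σ) ⊗_N L²(N_ρ) → L²(N_σ') ⊗_N L²(N_ρ')` of bimodule maps;
by `tensorHom_elemTensor` it sends `[x] ⊗ [y]` to `S [x] ⊗ T [y]`. -/
noncomputable def tensorHom (S : M.bimodHom σ σ') (T : M.bimodHom ρ ρ') :
    M.bimodHom (σ * ρ) (σ' * ρ') :=
  ⟨M.rightMul (symbol S * σ' (symbol T)), rightMul_mem M fun x => by
    change σ (ρ x) * (symbol S * σ' (symbol T)) = symbol S * σ' (symbol T) * σ' (ρ' x)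
    rw [← mul_assoc, symbol_comm, mul_assoc, mul_assoc, ← map_mul, ← map_mul, symbol_comm]⟩

theorem tensorHom_elemTensor (S : M.bimodHom σ σ') (T : M.bimodHom ρ ρ') (x y x' y' : M.Elt)
    (hS : S.1 (M.vec x) = M.vec x') (hT : T.1 (M.vec y) = M.vec y') :
    (tensorHom S T).1 (elemTensor σ x y) = elemTensor σ' x' y' := by
  rw [apply_vec] at hS hT
  have hx := M.vec_injective hS
  have hy := M.vec_injective hT
  unfold elemTensor tensorHom
  rw [rightMul_vec, ← hx, ← hy, map_mul, mul_assoc, mul_assoc, ← mul_assoc (σ y), symbol_comm,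
    mul_assoc]

theorem tensorHom_add_left (S S' : M.bimodHom σ σ') (T : M.bimodHom ρ ρ') :
    tensorHom (S + S') T = tensorHom S T + tensorHom S' T :=
  Subtype.ext (by
    change M.rightMul _ = M.rightMul _ + M.rightMul _
    rw [symbol_add, add_mul, rightMul_add])

theorem tensorHom_add_right (S : M.bimodHom σ σ') (T T' : M.bimodHom ρ ρ') :
    tensorHom S (T + T') = tensorHom S T + tensorHom S T' :=
  Subtype.ext (by
    change M.rightMul _ = M.rightMul _ + M.rightMul _
    rw [symbol_add, map_add, mul_add, rightMul_add])

theorem compHom_add_left (T T' : M.bimodHom σ' σ'') (S : M.bimodHom σ σ') :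
    compHom (T + T') S = compHom T S + compHom T' S := Subtype.ext (add_mul _ _ _)

theorem compHom_add_right (T : M.bimodHom σ' σ'') (S S' : M.bimodHom σ σ') :
    compHom T (S + S') = compHom T S + compHom T S' := Subtype.ext (mul_add _ _ _)

theorem adjHom_add (S T : M.bimodHom σ ρ) : adjHom (S + T) = adjHom S + adjHom T :=
  Subtype.ext (map_add _ _ _)

theorem castHom_add (h : σ = σ') (h' : ρ = ρ') (S T : M.bimodHom σ ρ) :
    castHom h h' (S + T) = castHom h h' S + castHom h h' T := rfl

end II1Factor

/-- Normalized `2`-cocycles `φ : K × K → S¹`. -/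
structure TwoCocycle (K : Type*) [Group K] where
  toFun : K → K → Circle
  cocycle : ∀ x y z, toFun x y * toFun (x * y) z = toFun y z * toFun x (y * z)
  one_left : ∀ x, toFun 1 x = 1
  one_right : ∀ x, toFun x 1 = 1

theorem TwoCocycle.apply_inv {K : Type*} [Group K] (φ : TwoCocycle K) (x : K) :
    φ.toFun x x⁻¹ = φ.toFun x⁻¹ x := by
  have h := φ.cocycle x x⁻¹ x
  rwa [mul_inv_cancel, inv_mul_cancel, φ.one_left, φ.one_right, mul_one, mul_one] at h

/-! ## `G`-kernels and their obstruction -/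

/-- An injective homomorphism `χ : G → Out(N)` (a `G`-kernel), given through a lift
`α : G → Aut(N)` with `α_e = id`, and unitaries `u(g, h) ∈ N` with
`α_g α_h = Ad_{u(g,h)} α_{gh}` and `u(g, e) = 1 = u(e, g)`. -/
structure GKernel {H : Type*} [NormedAddCommGroup H] [InnerProductSpace ℂ H] [CompleteSpace H]
    (M : II1Factor H) (G : Type*) [Group G] where
  α : G → M.Aut
  u : G → G → M.Elt
  u_unitary : ∀ g h, u g h ∈ unitary M.Elt
  α_mul : ∀ g h x, α g (α h x) = u g h * α (g * h) x * star (u g h)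
  α_one : α 1 = 1
  u_one_right : ∀ g, u g 1 = 1
  u_one_left : ∀ g, u 1 g = 1
  injective : ∀ g, (∃ v ∈ unitary M.Elt, ∀ x, α g x = v * x * star v) → g = 1

namespace GKernel

variable {H : Type*} [NormedAddCommGroup H] [InnerProductSpace ℂ H] [CompleteSpace H]
  {M : II1Factor H} {G : Type*} [Group G] (K : GKernel M G)

theorem α_map_mem_unitary (g : G) {v : M.Elt} (hv : v ∈ unitary M.Elt) :
    K.α g v ∈ unitary M.Elt := by
  rw [Unitary.mem_iff] at hv ⊢
  rw [← map_star, ← map_mul, ← map_mul, hv.1, hv.2, map_one]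
  exact ⟨rfl, rfl⟩

/-- Associativity in `G` gives a scalar `ω(g₁, g₂, g₃) ∈ S¹` relating the two products of
unitaries. -/
theorem exists_obstruction (g₁ g₂ g₃ : G) : ∃ c : Circle,
    K.u g₁ g₂ * K.u (g₁ * g₂) g₃ = (c : ℂ) • (K.α g₁ (K.u g₂ g₃) * K.u g₁ (g₂ * g₃)) := by
  set p := K.u g₁ g₂ * K.u (g₁ * g₂) g₃ with hp
  set q := K.α g₁ (K.u g₂ g₃) * K.u g₁ (g₂ * g₃) with hq
  have hpu : p ∈ unitary M.Elt := mul_mem (K.u_unitary _ _) (K.u_unitary _ _)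
  have hqu : q ∈ unitary M.Elt :=
    mul_mem (K.α_map_mem_unitary _ (K.u_unitary _ _)) (K.u_unitary _ _)
  have hpx : ∀ x, K.α g₁ (K.α g₂ (K.α g₃ x)) = p * K.α (g₁ * g₂ * g₃) x * star p := by
    intro x
    rw [K.α_mul g₁ g₂, K.α_mul (g₁ * g₂) g₃, hp, star_mul]
    simp only [mul_assoc]
  have hqx : ∀ x, K.α g₁ (K.α g₂ (K.α g₃ x)) = q * K.α (g₁ * g₂ * g₃) x * star q := by
    intro x
    rw [K.α_mul g₂ g₃, map_mul, map_mul, K.α_mul g₁, map_star, hq, star_mul]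
    simp only [mul_assoc]
  have hcomm : ∀ y, star q * p * y = y * (star q * p) := by
    intro y
    obtain ⟨x, rfl⟩ := (K.α (g₁ * g₂ * g₃)).surjective y
    have h := (hpx x).symm.trans (hqx x)
    calc star q * p * K.α (g₁ * g₂ * g₃) x
        = star q * (p * K.α (g₁ * g₂ * g₃) x * star p) * p := by
          rw [mul_assoc (star q) (_ * _) p, mul_assoc (p * _) (star p) p,
            Unitary.star_mul_self_of_mem hpu, mul_one,
            mul_assoc]
      _ = star q * (q * K.α (g₁ * g₂ * g₃) x * star q) * p := by rw [h]
      _ = (star q * q) * K.α (g₁ * g₂ * g₃) x * (star q * p) := by simp only [mul_assoc]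
      _ = K.α (g₁ * g₂ * g₃) x * (star q * p) := by
          rw [Unitary.star_mul_self_of_mem hqu, one_mul]
  obtain ⟨c, hc⟩ := M.factor _ (star q * p).2 fun x hx =>
    congrArg (Subtype.val) (hcomm ⟨x, hx⟩)
  have hc' : star q * p = c • (1 : M.Elt) := Subtype.ext hc
  have hpc : p = c • q := by
    calc p = q * (star q * p) := by rw [← mul_assoc, Unitary.mul_star_self_of_mem hqu, one_mul]
      _ = c • q := by rw [hc', mul_smul_comm, mul_one]
  have hnorm : ∀ v ∈ unitary M.Elt, ‖M.vec v‖ = 1 := by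
    intro v hv
    have h : ⟪M.vec v, M.vec v⟫_ℂ = ⟪M.vec 1, M.vec 1⟫_ℂ := by
      rw [II1Factor.inner_vec, II1Factor.inner_vec, Unitary.star_mul_self_of_mem hv, star_one,
        one_mul]
    have h1 : ‖M.vec (1 : M.Elt)‖ = 1 := M.norm_Ω
    rw [inner_self_eq_norm_sq_to_K, inner_self_eq_norm_sq_to_K, h1] at h
    have h2 : ‖M.vec v‖ ^ 2 = 1 := by
      have : ((‖M.vec v‖ ^ 2 : ℝ) : ℂ) = ((1 : ℝ) : ℂ) := by simpa using h
      exact_mod_cast this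
    nlinarith [norm_nonneg (M.vec v)]
  have hcn : ‖c‖ = 1 := by
    have h1 := hnorm p hpu
    have h2 : M.vec p = c • M.vec q := by rw [hpc]; rfl
    rw [h2, norm_smul, hnorm q hqu, mul_one] at h1
    exact h1
  exact ⟨⟨c, mem_sphere_zero_iff_norm.2 hcn⟩, hpc⟩

/-- The `3`-cocycle obstruction `ω : G³ → S¹`, determined by
`u(g₁, g₂) u(g₁ g₂, g₃) = ω(g₁, g₂, g₃) α_{g₁}(u(g₂, g₃)) u(g₁, g₂ g₃)`. -/
noncomputable def obstruction (g₁ g₂ g₃ : G) : Circle := (K.exists_obstruction g₁ g₂ g₃).choose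

theorem obstruction_spec (g₁ g₂ g₃ : G) : K.u g₁ g₂ * K.u (g₁ * g₂) g₃ =
    (K.obstruction g₁ g₂ g₃ : ℂ) • (K.α g₁ (K.u g₂ g₃) * K.u g₁ (g₂ * g₃)) :=
  (K.exists_obstruction g₁ g₂ g₃).choose_spec

theorem smul_unitary_cancel {c d : ℂ} {v : M.Elt} (hv : v ∈ unitary M.Elt)
    (h : c • v = d • v) : c = d := by
  have h1 : c • (1 : M.Elt) = d • (1 : M.Elt) := by
    rw [← Unitary.mul_star_self_of_mem hv, ← smul_mul_assoc, h, smul_mul_assoc]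
  have h2 : c • M.Ω = d • M.Ω := congrArg M.vec h1
  have h3 : M.Ω ≠ 0 := fun h0 => by
    have := M.norm_Ω
    rw [h0, norm_zero] at this
    exact zero_ne_one this
  exact smul_left_injective ℂ h3 h2

theorem obstruction_cocycle (g₁ g₂ g₃ g₄ : G) :
    K.obstruction g₁ g₂ g₃ * K.obstruction g₁ (g₂ * g₃) g₄ * K.obstruction g₂ g₃ g₄ =
      K.obstruction (g₁ * g₂) g₃ g₄ * K.obstruction g₁ g₂ (g₃ * g₄) := by
  have hv : K.α g₁ (K.α g₂ (K.u g₃ g₄)) * K.α g₁ (K.u g₂ (g₃ * g₄)) * K.u g₁ (g₂ * (g₃ * g₄)) ∈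
      unitary M.Elt :=
    mul_mem (mul_mem (K.α_map_mem_unitary _ (K.α_map_mem_unitary _ (K.u_unitary _ _)))
      (K.α_map_mem_unitary _ (K.u_unitary _ _))) (K.u_unitary _ _)
  have hA : K.u g₁ g₂ * K.u (g₁ * g₂) g₃ * K.u (g₁ * g₂ * g₃) g₄ =
      ((K.obstruction g₁ g₂ g₃ : ℂ) * K.obstruction g₁ (g₂ * g₃) g₄ * K.obstruction g₂ g₃ g₄) •
      (K.α g₁ (K.α g₂ (K.u g₃ g₄)) * K.α g₁ (K.u g₂ (g₃ * g₄)) * K.u g₁ (g₂ * (g₃ * g₄))) := by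
    rw [K.obstruction_spec, smul_mul_assoc, mul_assoc, mul_assoc g₁ g₂ g₃,
      K.obstruction_spec g₁ (g₂ * g₃) g₄, mul_smul_comm, ← mul_assoc, ← map_mul,
      K.obstruction_spec g₂ g₃ g₄, map_smul, map_mul, smul_mul_assoc, smul_smul, smul_smul,
      mul_assoc g₂ g₃ g₄]
  have hB : K.u g₁ g₂ * K.u (g₁ * g₂) g₃ * K.u (g₁ * g₂ * g₃) g₄ =
      ((K.obstruction (g₁ * g₂) g₃ g₄ : ℂ) * K.obstruction g₁ g₂ (g₃ * g₄)) •
      (K.α g₁ (K.α g₂ (K.u g₃ g₄)) * K.α g₁ (K.u g₂ (g₃ * g₄)) * K.u g₁ (g₂ * (g₃ * g₄))) := by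
    have h1 : K.u g₁ g₂ * K.α (g₁ * g₂) (K.u g₃ g₄) =
        K.α g₁ (K.α g₂ (K.u g₃ g₄)) * K.u g₁ g₂ := by
      rw [K.α_mul, mul_assoc, Unitary.star_mul_self_of_mem (K.u_unitary _ _), mul_one]
    rw [mul_assoc, K.obstruction_spec, mul_smul_comm, ← mul_assoc, h1, mul_assoc,
      K.obstruction_spec g₁ g₂ (g₃ * g₄), mul_smul_comm, smul_smul, mul_assoc]
  apply Circle.ext
  push_cast
  exact smul_unitary_cancel hv (hA.symm.trans hB)

theorem obstruction_eq_one_of {g₁ g₂ g₃ : G} (h : K.u g₁ g₂ * K.u (g₁ * g₂) g₃ =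
    K.α g₁ (K.u g₂ g₃) * K.u g₁ (g₂ * g₃)) : K.obstruction g₁ g₂ g₃ = 1 := by
  have hv : K.u g₁ g₂ * K.u (g₁ * g₂) g₃ ∈ unitary M.Elt :=
    mul_mem (K.u_unitary _ _) (K.u_unitary _ _)
  have h1 := K.obstruction_spec g₁ g₂ g₃
  rw [← h] at h1
  apply Circle.ext
  push_cast
  exact (smul_unitary_cancel hv ((one_smul ℂ _).trans h1)).symm

theorem obstruction_one_left (g h : G) : K.obstruction 1 g h = 1 :=
  K.obstruction_eq_one_of (by
    rw [K.u_one_left, K.u_one_left, K.α_one, one_mul, one_mul]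
    exact (one_mul _).symm)

theorem obstruction_one_mid (g h : G) : K.obstruction g 1 h = 1 :=
  K.obstruction_eq_one_of (by
    rw [K.u_one_left, K.u_one_right, map_one, mul_one, one_mul, one_mul, one_mul])

theorem obstruction_one_right (g h : G) : K.obstruction g h 1 = 1 :=
  K.obstruction_eq_one_of (by
    rw [K.u_one_right, K.u_one_right, map_one, mul_one, mul_one, one_mul])

/-- `φ_a(g, h) = ω̄(a, g, h) ω(g, a, h) ω̄(g, h, a)`. -/
noncomputable def phi (a g h : G) : Circle :=
  (K.obstruction a g h)⁻¹ * K.obstruction g a h * (K.obstruction g h a)⁻¹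

theorem phi_cocycle (a x y z : G) (hx : x * a = a * x) (hy : y * a = a * y) (hz : z * a = a * z) :
    K.phi a x y * K.phi a (x * y) z = K.phi a y z * K.phi a x (y * z) := by
  have h1 := congrArg Additive.ofMul (K.obstruction_cocycle a x y z)
  have h2 := congrArg Additive.ofMul (K.obstruction_cocycle x a y z)
  have h3 := congrArg Additive.ofMul (K.obstruction_cocycle x y a z)
  have h4 := congrArg Additive.ofMul (K.obstruction_cocycle x y z a)
  rw [hx] at h2
  rw [hy] at h3
  rw [hz] at h4
  apply Additive.ofMul.injective
  unfold phi
  simp only [ofMul_mul, ofMul_inv] at h1 h2 h3 h4 ⊢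
  linear_combination (norm := module) -h1 + h2 - h3 + h4

/-- For `a = g_C`, the `2`-cocycle `φ_C(s, t) = φ̄_a(t⁻¹, s⁻¹)` on the centralizer of `a`. -/
noncomputable def phiC (a : G) : TwoCocycle (Subgroup.centralizer ({a} : Set G)) where
  toFun s t := (K.phi a (t : G)⁻¹ (s : G)⁻¹)⁻¹
  cocycle x y z := by
    have hc : ∀ w : Subgroup.centralizer ({a} : Set G), (w : G)⁻¹ * a = a * (w : G)⁻¹ := fun w =>
      (Subgroup.mem_centralizer_iff.1 (w⁻¹).2 a rfl).symm
    have h := K.phi_cocycle a (z : G)⁻¹ (y : G)⁻¹ (x : G)⁻¹ (hc z) (hc y) (hc x)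
    rw [← mul_inv, ← mul_inv, inv_inj, Subgroup.coe_mul, Subgroup.coe_mul, mul_inv_rev, mul_inv_rev,
      mul_comm, mul_comm (K.phi a (z : G)⁻¹ (y : G)⁻¹)]
    rw [mul_comm, mul_comm (K.phi a (y : G)⁻¹ (x : G)⁻¹)] at h
    exact h.symm
  one_left s := by simp [phi, obstruction_one_mid, obstruction_one_right]
  one_right s := by simp [phi, obstruction_one_left, obstruction_one_mid]

/-! ## The tube algebra -/

open II1Factor

/-- `𝒯^s_{g₁,g₂}`, the bimodule maps `X_{g₁} ⊗_N X_s → X_s ⊗_N X_{g₂}`, where `X_g = L²(N_{α_g})`. -/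
noncomputable abbrev TubeHom (g₁ s g₂ : G) : Submodule ℂ (H →L[ℂ] H) :=
  M.bimodHom (K.α g₁ * K.α s) (K.α s * K.α g₂)

/-- `β_{s,t} : X_s ⊗_N X_t → X_{st}`, `[1] ⊗ [1] ↦ [u(s, t)]`. -/
noncomputable def beta (s t : G) : M.bimodHom (K.α s * K.α t) (K.α (s * t)) :=
  ⟨M.rightMul (K.u s t), rightMul_mem M fun x => by
    change K.α s (K.α t x) * K.u s t = _
    rw [K.α_mul, mul_assoc, Unitary.star_mul_self_of_mem (K.u_unitary s t), mul_one]⟩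

/-- The product `𝒯^t_{g₂,g₃} × 𝒯^s_{g₁,g₂} → 𝒯^{st}_{g₁,g₃}`,
`b · a = (β_{s,t} ⊗ id_{X_{g₃}}) ∘ (id_{X_s} ⊗ b) ∘ (a ⊗ id_{X_t}) ∘ (id_{X_{g₁}} ⊗ β*_{s,t})`. -/
noncomputable def tubeMul {g₁ g₂ g₃ s t : G} (b : K.TubeHom g₂ t g₃) (a : K.TubeHom g₁ s g₂) :
    K.TubeHom g₁ (s * t) g₃ :=
  compHom (tensorHom (K.beta s t) (idHom (K.α g₃)))
    (compHom (castHom rfl (mul_assoc _ _ _).symm (tensorHom (idHom (K.α s)) b))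
      (compHom (castHom rfl (mul_assoc _ _ _) (tensorHom a (idHom (K.α t))))
        (castHom rfl (mul_assoc _ _ _).symm
          (tensorHom (idHom (K.α g₁)) (adjHom (K.beta s t))))))

/-- `R_s = β*_{s⁻¹,s}`, as a map from the unit object `X_e = L²(N)`. -/
noncomputable def conjR (s : G) : M.bimodHom 1 (K.α s⁻¹ * K.α s) :=
  castHom (by rw [inv_mul_cancel, K.α_one]) rfl (adjHom (K.beta s⁻¹ s))

/-- `R̄_s = ω(s, s⁻¹, s) β*_{s,s⁻¹}`, as a map from the unit object; `(R_s, R̄_s)` is a standard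
solution of the conjugate equations for `(X_s, X_{s⁻¹})`. -/
noncomputable def conjRbar (s : G) : M.bimodHom 1 (K.α s * K.α s⁻¹) :=
  castHom (by rw [mul_inv_cancel, K.α_one]) rfl
    ((K.obstruction s s⁻¹ s : ℂ) • adjHom (K.beta s s⁻¹))

/-- The involution `𝒯^s_{g₁,g₂} → 𝒯^{s⁻¹}_{g₂,g₁}`,
`a^# = (id ⊗ id ⊗ R̄_s*) ∘ (id ⊗ a* ⊗ id) ∘ (R_s ⊗ id ⊗ id)`. -/
noncomputable def tubeStar {g₁ g₂ s : G} (a : K.TubeHom g₁ s g₂) : K.TubeHom g₂ s⁻¹ g₁ :=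
  compHom
    (castHom rfl (by rw [mul_one])
      (tensorHom (idHom (K.α s⁻¹)) (tensorHom (idHom (K.α g₁)) (adjHom (K.conjRbar s)))))
    (compHom
      (castHom rfl (by simp only [mul_assoc])
        (tensorHom (idHom (K.α s⁻¹)) (tensorHom (adjHom a) (idHom (K.α s⁻¹)))))
      (castHom (by rw [one_mul]) (by simp only [mul_assoc])
        (tensorHom (K.conjR s) (tensorHom (idHom (K.α g₂)) (idHom (K.α s⁻¹))))))

theorem tubeMul_add_left {g₁ g₂ g₃ s t : G} (b b' : K.TubeHom g₂ t g₃) (a : K.TubeHom g₁ s g₂) :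
    K.tubeMul (b + b') a = K.tubeMul b a + K.tubeMul b' a := by
  unfold tubeMul
  rw [tensorHom_add_right, castHom_add, compHom_add_left, compHom_add_right]

theorem tubeMul_add_right {g₁ g₂ g₃ s t : G} (b : K.TubeHom g₂ t g₃) (a a' : K.TubeHom g₁ s g₂) :
    K.tubeMul b (a + a') = K.tubeMul b a + K.tubeMul b a' := by
  unfold tubeMul
  rw [tensorHom_add_left, castHom_add, compHom_add_left, compHom_add_right, compHom_add_right]

theorem tubeStar_add {g₁ g₂ s : G} (a a' : K.TubeHom g₁ s g₂) :
    K.tubeStar (a + a') = K.tubeStar a + K.tubeStar a' := by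
  unfold tubeStar
  rw [adjHom_add, tensorHom_add_left, tensorHom_add_right, castHom_add, compHom_add_left,
    compHom_add_right]

/-- The vector space `⨁_{g₁,g₂} ⨁_s 𝒯^s_{g₁,g₂}`; the index is `(g₁, s, g₂)`. -/
abbrev TubeSum : Type _ := ⨁ p : G × G × G, K.TubeHom p.1 p.2.1 p.2.2

/-- The tube algebra `𝒯 = ((𝒯_{g₁,g₂}))_{fin. supp.}`, `𝒯_{g₁,g₂} = ⨁_s 𝒯^s_{g₁,g₂}`. -/
def Tube : Type _ := K.TubeSum

noncomputable instance : AddCommGroup K.Tube := inferInstanceAs (AddCommGroup K.TubeSum)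

noncomputable instance : Module ℂ K.Tube := inferInstanceAs (Module ℂ K.TubeSum)

open Classical in
/-- The inclusion of `𝒯^s_{g₁,g₂}`. -/
noncomputable def sumOf (g₁ s g₂ : G) : K.TubeHom g₁ s g₂ →+ K.TubeSum :=
  DirectSum.of (fun p : G × G × G => K.TubeHom p.1 p.2.1 p.2.2) (g₁, s, g₂)

/-- The inclusion of `𝒯^s_{g₁,g₂}` in the tube algebra. -/
noncomputable def tubeOf (g₁ s g₂ : G) (a : K.TubeHom g₁ s g₂) : K.Tube := K.sumOf g₁ s g₂ a

open Classical in
/-- The product of homogeneous elements: `𝒯_{g₂',g₃} 𝒯_{g₁,g₂} = 0` unless `g₂ = g₂'`. -/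
noncomputable def tubeMulHom (q p : G × G × G) :
    K.TubeHom q.1 q.2.1 q.2.2 →+ K.TubeHom p.1 p.2.1 p.2.2 →+ K.TubeSum :=
  if h : p.2.2 = q.1 then
    AddMonoidHom.mk' (fun b => AddMonoidHom.mk'
        (fun a => K.sumOf p.1 (p.2.1 * q.2.1) q.2.2
          (K.tubeMul b (castHom rfl (by rw [h]) a)))
        fun a a' => by rw [castHom_add, tubeMul_add_right, map_add])
      fun b b' => by
        ext a
        simp only [AddMonoidHom.mk'_apply, AddMonoidHom.add_apply]
        rw [tubeMul_add_left, map_add]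
  else 0

open Classical in
/-- The product of the tube algebra. -/
noncomputable def tubeMulBilin : K.TubeSum →+ K.TubeSum →+ K.TubeSum :=
  DirectSum.toAddMonoid fun q =>
    (DirectSum.toAddMonoid fun p => (K.tubeMulHom q p).flip).flip

noncomputable instance : NonUnitalNonAssocRing K.Tube where
  mul x y := K.tubeMulBilin x y
  left_distrib x y z := map_add (K.tubeMulBilin x) y z
  right_distrib x y z := by
    change K.tubeMulBilin (x + y) z = K.tubeMulBilin x z + K.tubeMulBilin y z
    exact congrArg (fun f => f z) (map_add K.tubeMulBilin x y)
  zero_mul x := congrArg (fun f => f x) (map_zero K.tubeMulBilin)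
  mul_zero x := map_zero (K.tubeMulBilin x)

open Classical in
theorem tubeOf_mul_tubeOf {g₁ g₂ g₃ s t : G} (b : K.TubeHom g₂ t g₃) (a : K.TubeHom g₁ s g₂) :
    K.tubeOf g₂ t g₃ b * K.tubeOf g₁ s g₂ a = K.tubeOf g₁ (s * t) g₃ (K.tubeMul b a) := by
  change K.tubeMulBilin (K.sumOf _ _ _ b) (K.sumOf _ _ _ a) = K.sumOf _ _ _ _
  unfold tubeMulBilin sumOf
  rw [DirectSum.toAddMonoid_of, AddMonoidHom.flip_apply, DirectSum.toAddMonoid_of,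
    AddMonoidHom.flip_apply]
  unfold tubeMulHom
  rw [dif_pos rfl]
  rfl

open Classical in
theorem tubeOf_mul_tubeOf_of_ne {g₁ g₂ g₂' g₃ s t : G} (h : g₂ ≠ g₂') (b : K.TubeHom g₂' t g₃)
    (a : K.TubeHom g₁ s g₂) : K.tubeOf g₂' t g₃ b * K.tubeOf g₁ s g₂ a = 0 := by
  change K.tubeMulBilin (K.sumOf _ _ _ b) (K.sumOf _ _ _ a) = 0
  unfold tubeMulBilin sumOf
  rw [DirectSum.toAddMonoid_of, AddMonoidHom.flip_apply, DirectSum.toAddMonoid_of,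
    AddMonoidHom.flip_apply]
  unfold tubeMulHom
  rw [dif_neg h]
  rfl

open Classical in
/-- The involution of the tube algebra, on the underlying direct sum. -/
noncomputable def tubeStarHom : K.TubeSum →+ K.TubeSum :=
  DirectSum.toAddMonoid fun p : G × G × G =>
    (K.sumOf p.2.2 p.2.1⁻¹ p.1).comp (AddMonoidHom.mk' K.tubeStar K.tubeStar_add)

/-- The involution `#` of the tube algebra. -/
noncomputable instance : Star K.Tube where
  star := K.tubeStarHom

open Classical in
theorem star_tubeOf {g₁ g₂ s : G} (a : K.TubeHom g₁ s g₂) :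
    star (K.tubeOf g₁ s g₂ a) = K.tubeOf g₂ s⁻¹ g₁ (K.tubeStar a) := by
  change K.tubeStarHom (K.sumOf _ _ _ a) = K.sumOf _ _ _ _
  unfold tubeStarHom
  conv_lhs => unfold sumOf
  rw [DirectSum.toAddMonoid_of]
  rfl

/-- For `g₁ s = s g₂`, the map `a(g₁, s, g₂) : [1]_{g₁} ⊗ [1]_s ↦ [u(g₁, s) u*(s, g₂)]_s ⊗ [1]_{g₂}`
in `𝒯^s_{g₁,g₂}`. -/
noncomputable def gen (g₁ s g₂ : G) (h : g₁ * s = s * g₂) : K.TubeHom g₁ s g₂ :=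
  ⟨M.rightMul (K.u g₁ s * star (K.u s g₂)), rightMul_mem M fun x => by
    change K.α g₁ (K.α s x) * _ = _ * K.α s (K.α g₂ x)
    rw [K.α_mul, K.α_mul, h]
    simp only [mul_assoc]
    rw [← mul_assoc (star (K.u g₁ s)), ← mul_assoc (star (K.u s g₂)) (K.u s g₂),
      Unitary.star_mul_self_of_mem (K.u_unitary _ _),
      Unitary.star_mul_self_of_mem (K.u_unitary _ _), one_mul, one_mul]⟩

/-- The projection `a(g, e, g)` of the tube algebra. -/
noncomputable def tubeProj (g : G) : K.Tube :=
  K.tubeOf g 1 g (K.gen g 1 g (by rw [mul_one, one_mul]))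

end GKernel

/-! ## Matrix algebras, twisted group algebras and finite direct sums -/

/-- Finitely supported complex matrices with rows and columns indexed by `ι`; the entry at `(i, j)`
of `A` is `A (i, j)`. -/
def FinMatrix (ι : Type*) : Type _ := ι × ι →₀ ℂ

namespace FinMatrix

variable {ι : Type*}

noncomputable instance : AddCommGroup (FinMatrix ι) := inferInstanceAs (AddCommGroup (ι × ι →₀ ℂ))

noncomputable instance : Module ℂ (FinMatrix ι) := inferInstanceAs (Module ℂ (ι × ι →₀ ℂ))

open Classical in
/-- Matrix multiplication, `E_{ij} E_{kl} = δ_{jk} E_{il}`. -/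
noncomputable def mulBilin : (ι × ι →₀ ℂ) →ₗ[ℂ] (ι × ι →₀ ℂ) →ₗ[ℂ] (ι × ι →₀ ℂ) :=
  Finsupp.lift _ ℂ _ fun p => Finsupp.lift _ ℂ _ fun q =>
    if p.2 = q.1 then Finsupp.single (p.1, q.2) 1 else 0

noncomputable instance : NonUnitalNonAssocRing (FinMatrix ι) where
  mul A B := mulBilin A B
  left_distrib A B C := map_add (mulBilin A) B C
  right_distrib A B C := LinearMap.map_add₂ mulBilin A B C
  zero_mul A := LinearMap.map_zero₂ mulBilin A
  mul_zero A := map_zero (mulBilin A)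

instance : IsScalarTower ℂ (FinMatrix ι) (FinMatrix ι) :=
  ⟨fun c A B => LinearMap.map_smul₂ mulBilin c A B⟩

instance : SMulCommClass ℂ (FinMatrix ι) (FinMatrix ι) :=
  ⟨fun c A B => ((mulBilin A).map_smul c B).symm⟩

/-- The matrix unit `E_{ij}`. -/
noncomputable def E (i j : ι) : FinMatrix ι := Finsupp.single (i, j) (1 : ℂ)

theorem E_mul_E (i j l : ι) : E i j * E j l = E i l := by
  change mulBilin (Finsupp.single (i, j) 1) (Finsupp.single (j, l) 1) = Finsupp.single (i, l) 1
  simp [mulBilin, Finsupp.lift_apply]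

theorem E_mul_E_of_ne (i l : ι) {j k : ι} (h : j ≠ k) : E i j * E k l = 0 := by
  change mulBilin (Finsupp.single (i, j) 1) (Finsupp.single (k, l) 1) = 0
  simp [mulBilin, Finsupp.lift_apply, h]

/-- Conjugate transpose. -/
noncomputable instance : StarAddMonoid (FinMatrix ι) where
  star A := Finsupp.mapRange star (star_zero ℂ)
    (Finsupp.equivMapDomain (Equiv.prodComm ι ι) (A : ι × ι →₀ ℂ))
  star_involutive _ := Finsupp.ext fun _ => star_star _
  star_add _ _ := Finsupp.ext fun _ => star_add _ _

instance : StarModule ℂ (FinMatrix ι) := ⟨fun c _ => Finsupp.ext fun _ => star_smul c _⟩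

end FinMatrix

/-- The twisted group algebra `[ℂK]_φ` of a normalized `2`-cocycle `φ : K × K → S¹`, with basis
`[s]`, `s ∈ K`, `[s] [t] = φ(s, t) [s t]` and `[s]* = φ̄(s⁻¹, s) [s⁻¹]`, which is `[s]⁻¹`. -/
def TwistedGroupAlgebra {K : Type*} [Group K] (_φ : TwoCocycle K) : Type _ := K →₀ ℂ

namespace TwistedGroupAlgebra

variable {K : Type*} [Group K] (φ : TwoCocycle K)

noncomputable instance : AddCommGroup (TwistedGroupAlgebra φ) :=
  inferInstanceAs (AddCommGroup (K →₀ ℂ))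

noncomputable instance : Module ℂ (TwistedGroupAlgebra φ) := inferInstanceAs (Module ℂ (K →₀ ℂ))

/-- Multiplication, `[s] [t] = φ(s, t) [s t]`. -/
noncomputable def mulBilin : (K →₀ ℂ) →ₗ[ℂ] (K →₀ ℂ) →ₗ[ℂ] (K →₀ ℂ) :=
  Finsupp.lift _ ℂ _ fun s => Finsupp.lift _ ℂ _ fun t =>
    Finsupp.single (s * t) (φ.toFun s t : ℂ)

noncomputable instance : NonUnitalNonAssocRing (TwistedGroupAlgebra φ) where
  mul x y := mulBilin φ x y
  left_distrib x y z := map_add (mulBilin φ x) y z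
  right_distrib x y z := LinearMap.map_add₂ (mulBilin φ) x y z
  zero_mul x := LinearMap.map_zero₂ (mulBilin φ) x
  mul_zero x := map_zero (mulBilin φ x)

instance : IsScalarTower ℂ (TwistedGroupAlgebra φ) (TwistedGroupAlgebra φ) :=
  ⟨fun c x y => LinearMap.map_smul₂ (mulBilin φ) c x y⟩

instance : SMulCommClass ℂ (TwistedGroupAlgebra φ) (TwistedGroupAlgebra φ) :=
  ⟨fun c x y => ((mulBilin φ x).map_smul c y).symm⟩

/-- The basis element `[s]`. -/
noncomputable def basisElt (s : K) : TwistedGroupAlgebra φ := Finsupp.single s (1 : ℂ)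

theorem basisElt_mul_basisElt (s t : K) :
    basisElt φ s * basisElt φ t = (φ.toFun s t : ℂ) • basisElt φ (s * t) := by
  have h : mulBilin φ (Finsupp.single s 1) (Finsupp.single t 1) =
      (Finsupp.single (s * t) (φ.toFun s t : ℂ) : K →₀ ℂ) := by
    rw [mulBilin, Finsupp.lift_apply, Finsupp.sum_single_index, one_smul, Finsupp.lift_apply,
      Finsupp.sum_single_index, one_smul] <;> exact zero_smul ℂ _
  have h' : (φ.toFun s t : ℂ) • (Finsupp.single (s * t) (1 : ℂ) : K →₀ ℂ) =
      Finsupp.single (s * t) (φ.toFun s t : ℂ) := by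
    rw [Finsupp.smul_single, smul_eq_mul, mul_one]
  exact h.trans h'.symm

variable {φ} in
/-- The coefficient of `[s]`. -/
def coeff (x : TwistedGroupAlgebra φ) (s : K) : ℂ := DFunLike.coe (F := K →₀ ℂ) x s

variable {φ} in
theorem ext_coeff {x y : TwistedGroupAlgebra φ} (h : ∀ s, x.coeff s = y.coeff s) : x = y :=
  Finsupp.ext h

/-- The involution, `[s]* = φ̄(s⁻¹, s) [s⁻¹]`. -/
noncomputable instance : Star (TwistedGroupAlgebra φ) where
  star x := Finsupp.onFinset ((Finsupp.support (M := ℂ) x).map (Equiv.inv K).toEmbedding)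
    (fun s => star (φ.toFun s s⁻¹ : ℂ) * star (x.coeff s⁻¹)) (by
      intro s hs
      refine Finset.mem_map.2 ⟨s⁻¹, Finsupp.mem_support_iff.2 fun h0 => hs ?_, inv_inv s⟩
      have h1 : x.coeff s⁻¹ = 0 := h0
      rw [h1, star_zero, mul_zero])

theorem coeff_star (x : TwistedGroupAlgebra φ) (s : K) :
    (star x).coeff s = star (φ.toFun s s⁻¹ : ℂ) * star (x.coeff s⁻¹) := rfl

noncomputable instance : StarAddMonoid (TwistedGroupAlgebra φ) where
  star_involutive x := ext_coeff fun s => by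
    have h : star (φ.toFun s s⁻¹ : ℂ) * (φ.toFun s s⁻¹ : ℂ) = 1 := by
      rw [Complex.star_def, ← Circle.coe_inv_eq_conj, ← Circle.coe_mul, inv_mul_cancel,
        Circle.coe_one]
    rw [coeff_star, coeff_star, star_mul', star_star, star_star, inv_inv, ← φ.apply_inv,
      ← mul_assoc, h, one_mul]
  star_add x y := ext_coeff fun s => by
    change star (φ.toFun s s⁻¹ : ℂ) * star (x.coeff s⁻¹ + y.coeff s⁻¹) = _
    rw [star_add, mul_add]
    rfl

instance : StarModule ℂ (TwistedGroupAlgebra φ) :=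
  ⟨fun c x => ext_coeff fun s => by
    change star (φ.toFun s s⁻¹ : ℂ) * star (c * x.coeff s⁻¹) =
      star c * (star (φ.toFun s s⁻¹ : ℂ) * star (x.coeff s⁻¹))
    rw [star_mul']
    ring⟩

end TwistedGroupAlgebra

/-- The direct sum `⨁ᵢ Aᵢ` of (not necessarily unital) algebras, with componentwise operations. -/
def AlgSum {ι : Type*} (A : ι → Type*) [∀ i, NonUnitalNonAssocRing (A i)] : Type _ := Π₀ i, A i

namespace AlgSum

variable {ι : Type*} (A : ι → Type*) [∀ i, NonUnitalNonAssocRing (A i)]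

noncomputable instance : AddCommGroup (AlgSum A) := inferInstanceAs (AddCommGroup (Π₀ i, A i))

noncomputable instance [∀ i, Module ℂ (A i)] : Module ℂ (AlgSum A) :=
  inferInstanceAs (Module ℂ (Π₀ i, A i))

noncomputable instance : NonUnitalNonAssocRing (AlgSum A) where
  mul := DFinsupp.zipWith (fun _ x y => x * y) fun _ => mul_zero 0
  left_distrib _ _ _ := DFinsupp.ext fun _ => mul_add _ _ _
  right_distrib _ _ _ := DFinsupp.ext fun _ => add_mul _ _ _
  zero_mul _ := DFinsupp.ext fun _ => zero_mul _
  mul_zero _ := DFinsupp.ext fun _ => mul_zero _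

noncomputable instance [∀ i, StarAddMonoid (A i)] : Star (AlgSum A) where
  star := DFinsupp.mapRange (fun _ x => star x) fun _ => star_zero _

end AlgSum

/-- The algebra `⨁_C M_C ⊗ [ℂG_C]_{φ_C}`, for a choice `r` of representatives `g_C = r C`. -/
abbrev GKernel.ClassAlgebra {H : Type*} [NormedAddCommGroup H] [InnerProductSpace ℂ H]
    [CompleteSpace H] {M : II1Factor H} {G : Type*} [Group G] (K : GKernel M G)
    (r : ConjClasses G → G) : Type _ :=
  AlgSum fun C : ConjClasses G =>
    FinMatrix C.carrier ⊗[ℂ] TwistedGroupAlgebra (K.phiC (r C))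

/-! ## Hilbert space representations -/

universe u v w

/-- A (nondegenerate) Hilbert space representation `π : A → 𝓛(V)` of a star algebra by bounded
operators. -/
structure HilbRep (A : Type*) [NonUnitalNonAssocRing A] [Module ℂ A] [Star A] where
  V : Type w
  [normed : NormedAddCommGroup V]
  [inner : InnerProductSpace ℂ V]
  [complete : CompleteSpace V]
  π : A →⋆ₙₐ[ℂ] (V →L[ℂ] V)
  nondegenerate : (Submodule.span ℂ {v : V | ∃ x ξ, π x ξ = v}).topologicalClosure = ⊤

namespace HilbRep

variable {A : Type*} [NonUnitalNonAssocRing A] [Module ℂ A] [Star A]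

attribute [instance] normed inner complete

/-- Bounded intertwiners. -/
@[ext]
structure Hom (X Y : HilbRep.{w} A) where
  toMap : X.V →L[ℂ] Y.V
  comm : ∀ x ξ, toMap (X.π x ξ) = Y.π x (toMap ξ)

instance : Category (HilbRep.{w} A) where
  Hom := Hom
  id X := ⟨ContinuousLinearMap.id ℂ X.V, fun _ _ => rfl⟩
  comp f g := ⟨g.toMap.comp f.toMap, fun x ξ => by
    rw [ContinuousLinearMap.comp_apply, ContinuousLinearMap.comp_apply, f.comm, g.comm]⟩

/-- Intertwiners as a subspace of the bounded operators. -/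
def homSubmodule (X Y : HilbRep.{w} A) : Submodule ℂ (X.V →L[ℂ] Y.V) where
  carrier := {T | ∀ x ξ, T (X.π x ξ) = Y.π x (T ξ)}
  zero_mem' := by simp
  add_mem' := fun h h' x ξ => by simp [h x ξ, h' x ξ]
  smul_mem' := fun c _ h x ξ => by simp [h x ξ]

/-- The two descriptions of intertwiners agree. -/
def homEquiv (X Y : HilbRep.{w} A) : (X ⟶ Y) ≃ homSubmodule X Y where
  toFun f := ⟨f.toMap, f.comm⟩
  invFun f := ⟨f.1, f.2⟩
  left_inv _ := rfl
  right_inv _ := rfl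

noncomputable instance (X Y : HilbRep.{w} A) : AddCommGroup (X ⟶ Y) := (homEquiv X Y).addCommGroup

noncomputable instance (X Y : HilbRep.{w} A) : Module ℂ (X ⟶ Y) := (homEquiv X Y).module ℂ

noncomputable instance : Preadditive (HilbRep.{w} A) where
  add_comp X Y Z f f' g := Hom.ext (ContinuousLinearMap.comp_add g.toMap f.toMap f'.toMap)
  comp_add X Y Z f g g' := Hom.ext (ContinuousLinearMap.add_comp g.toMap g'.toMap f.toMap)

noncomputable instance : Linear ℂ (HilbRep.{w} A) where
  smul_comp X Y Z c f g := Hom.ext (ContinuousLinearMap.comp_smul g.toMap c f.toMap)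
  comp_smul X Y Z f c g := Hom.ext (ContinuousLinearMap.smul_comp c g.toMap f.toMap)

variable (X : HilbRep.{w} A)

/-- `W` is a submodule of `V`: a closed subspace invariant under the representation. -/
def IsSubmodule (W : Submodule ℂ X.V) : Prop :=
  IsClosed (W : Set X.V) ∧ ∀ x, ∀ ξ ∈ W, X.π x ξ ∈ W

/-- The submodule generated by a set of vectors. -/
def generated (S : Set X.V) : Submodule ℂ X.V := sInf {W | X.IsSubmodule W ∧ S ⊆ W}

end HilbRep

namespace GKernel

variable {H : Type*} [NormedAddCommGroup H] [InnerProductSpace ℂ H] [CompleteSpace H]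
  {M : II1Factor H} {G : Type*} [Group G] (K : GKernel M G)

/-- The `g`-th space `V_g` of a representation of the tube algebra, the range of
`Π(a(g, e, g))`. -/
def weightSpace (X : HilbRep.{w} K.Tube) (g : G) : Set X.V := Set.range (X.π (K.tubeProj g))

/-- A representation of the tube algebra is supported on the class of `g = g_C` if it is generated
by its vectors in the `g`-th space. -/
def supportedOn (g : G) : ObjectProperty (HilbRep.{w} K.Tube) :=
  fun X => X.generated (K.weightSpace X g) = ⊤

/-- `V` is the orthogonal direct sum (as a Hilbert space) of the submodules `W C`, where `W C` is
supported on `C`, that is, generated by its vectors in the `g_C`-th space. -/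
structure IsClassDecomposition (r : ConjClasses G → G) (X : HilbRep.{w} K.Tube)
    (W : ConjClasses G → Submodule ℂ X.V) : Prop where
  isSubmodule : ∀ C, X.IsSubmodule (W C)
  supported : ∀ C, X.generated (W C ∩ K.weightSpace X (r C)) = W C
  orthogonal : ∀ C D, C ≠ D → W C ⟂ W D
  total : (⨆ C, W C).topologicalClosure = ⊤

end GKernel

theorem Circle.star_coe (c : Circle) : star (c : ℂ) = ((c⁻¹ : Circle) : ℂ) :=
  (Circle.coe_inv_eq_conj c).symm

theorem Circle.star_coe_inv (c : Circle) : star ((c⁻¹ : Circle) : ℂ) = (c : ℂ) := by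
  rw [← Circle.star_coe, star_star]

theorem Circle.coe_mul_inv (c : Circle) : (c : ℂ) * ((c⁻¹ : Circle) : ℂ) = 1 := by
  rw [← Circle.coe_mul, mul_inv_cancel, Circle.coe_one]

theorem Circle.coe_inv_mul (c : Circle) : ((c⁻¹ : Circle) : ℂ) * (c : ℂ) = 1 := by
  rw [← Circle.coe_mul, inv_mul_cancel, Circle.coe_one]

namespace II1Factor

variable {H : Type*} [NormedAddCommGroup H] [InnerProductSpace ℂ H] [CompleteSpace H]
  {M : II1Factor H} {σ σ' σ'' ρ ρ' ρ'' : M.Aut}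

theorem symbol_injective : Function.Injective (symbol (σ := σ) (ρ := ρ)) := by
  intro S T h
  apply Subtype.ext
  rw [← rightMul_symbol S, ← rightMul_symbol T, h]

theorem symbol_smul (c : ℂ) (T : M.bimodHom σ ρ) : symbol (c • T) = c • symbol T :=
  symbol_eq_of (by rw [rightMul_smul, rightMul_symbol]; rfl)

theorem symbol_idHom (σ : M.Aut) : symbol (idHom σ) = 1 :=
  symbol_eq_of M.rightMul_one.symm

theorem symbol_compHom (T : M.bimodHom σ' σ'') (S : M.bimodHom σ σ') :
    symbol (compHom T S) = symbol S * symbol T :=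
  symbol_eq_of (by rw [rightMul_mul, rightMul_symbol, rightMul_symbol]; rfl)

theorem symbol_adjHom (T : M.bimodHom σ ρ) : symbol (adjHom T) = star (symbol T) :=
  symbol_eq_of (by rw [rightMul_star, rightMul_symbol]; rfl)

theorem symbol_castHom (h : σ = σ') (h' : ρ = ρ') (T : M.bimodHom σ ρ) :
    symbol (castHom h h' T) = symbol T :=
  symbol_eq_of (rightMul_symbol T).symm

theorem symbol_tensorHom (S : M.bimodHom σ σ') (T : M.bimodHom ρ ρ') :
    symbol (tensorHom S T) = symbol S * σ' (symbol T) :=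
  symbol_eq_of rfl

theorem exists_smul_one_of_comm (σ : M.Aut) (z : M.Elt) (hz : ∀ x, z * σ x = σ x * z) :
    ∃ c : ℂ, z = c • (1 : M.Elt) := by
  obtain ⟨c, hc⟩ := M.factor z z.2 fun x hx => by
    obtain ⟨y, hy⟩ := σ.surjective ⟨x, hx⟩
    have h := hz y
    change σ y = _ at hy
    rw [hy] at h
    exact congrArg Subtype.val h
  exact ⟨c, Subtype.ext hc⟩

/-- A nonzero intertwiner of automorphisms of a factor is a multiple of a unitary. -/
theorem exists_unitary_of_intertwiner (v : M.Elt) (hv : ∀ x, σ x * v = v * ρ x) (h0 : v ≠ 0) :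
    ∃ w ∈ unitary M.Elt, ∀ x, σ x * w = w * ρ x := by
  have hv' : ∀ x, star v * σ x = ρ x * star v := fun x => by
    have h := congrArg star (hv (star x))
    rwa [star_mul, star_mul, ← map_star, ← map_star, star_star] at h
  obtain ⟨c, hc⟩ := exists_smul_one_of_comm ρ (star v * v) fun x => by
    rw [mul_assoc, ← hv, ← mul_assoc, hv', mul_assoc]
  obtain ⟨d, hd⟩ := exists_smul_one_of_comm σ (v * star v) fun x => by
    rw [mul_assoc, hv', ← mul_assoc, ← hv, mul_assoc]
  have hvΩ : M.vec v ≠ 0 := fun h => h0 (M.vec_injective (h.trans rfl))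
  have hcn : c = ((‖M.vec v‖ ^ 2 : ℝ) : ℂ) := by
    have h1 : ⟪M.vec v, M.vec v⟫_ℂ = c := by
      rw [inner_vec, hc]
      change ⟪M.Ω, c • M.Ω⟫_ℂ = c
      rw [inner_smul_right, inner_self_eq_norm_sq_to_K, M.norm_Ω]
      simp
    rw [← h1, inner_self_eq_norm_sq_to_K]
    push_cast
    rfl
  have hcd : c • v = d • v := by
    have h1 : v * (star v * v) = v * star v * v := (mul_assoc _ _ _).symm
    rwa [hc, hd, mul_smul_comm, smul_mul_assoc, mul_one, one_mul] at h1
  have hcd' : d = c := by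
    have h1 : c • M.vec v = d • M.vec v := congrArg M.vec hcd
    exact (smul_left_injective ℂ hvΩ h1).symm
  subst hcd'
  set n : ℝ := ‖M.vec v‖ with hn
  have hn0 : n ≠ 0 := norm_ne_zero_iff.2 hvΩ
  have hk : star (((n⁻¹ : ℝ)) : ℂ) = ((n⁻¹ : ℝ) : ℂ) := Complex.conj_ofReal _
  have hk2 : ((n⁻¹ : ℝ) : ℂ) * (((n⁻¹ : ℝ) : ℂ) * d) = 1 := by
    rw [hcn]
    norm_cast
    field_simp
  refine ⟨((n⁻¹ : ℝ) : ℂ) • v, ?_, fun x => ?_⟩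
  · rw [Unitary.mem_iff, star_smul, hk]
    simp only [smul_mul_assoc, mul_smul_comm, hc, hd, smul_smul]
    rw [hk2, one_smul]
    exact ⟨rfl, rfl⟩
  · rw [mul_smul_comm, smul_mul_assoc, hv]

end II1Factor

namespace GKernel

open II1Factor

variable {H : Type*} [NormedAddCommGroup H] [InnerProductSpace ℂ H] [CompleteSpace H]
  {M : II1Factor H} {G : Type*} [Group G] (K : GKernel M G)

theorem star_u_mul_u (g h : G) : star (K.u g h) * K.u g h = 1 :=
  Unitary.star_mul_self_of_mem (K.u_unitary g h)

theorem u_mul_star_u (g h : G) : K.u g h * star (K.u g h) = 1 :=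
  Unitary.mul_star_self_of_mem (K.u_unitary g h)

theorem eq_of_tubeHom_ne_zero {g₁ s g₂ : G} {a : K.TubeHom g₁ s g₂} (ha : a ≠ 0) :
    g₁ * s = s * g₂ := by
  have h0 : symbol a ≠ 0 := fun h => ha (symbol_injective (h.trans
    (symbol_eq_of (by
      have := M.rightMul_smul 0 0
      rw [zero_smul, zero_smul] at this
      exact this.symm)).symm))
  obtain ⟨w, hw, hwx⟩ := exists_unitary_of_intertwiner _ (symbol_comm a) h0
  have hαu : ∀ g h x, K.α (g * h) x = star (K.u g h) * K.α g (K.α h x) * K.u g h := fun g h x => by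
    rw [K.α_mul]
    simp only [mul_assoc, star_u_mul_u, mul_one]
    rw [← mul_assoc, star_u_mul_u, one_mul]
  -- the inner automorphism relating `α (g₁ * s)` and `α (s * g₂)`
  obtain ⟨z, hz, hzx⟩ : ∃ z ∈ unitary M.Elt, ∀ x,
      K.α (g₁ * s) x = z * K.α (s * g₂) x * star z := by
    refine ⟨star (K.u g₁ s) * w * K.u s g₂, mul_mem (mul_mem
      (Unitary.star_mem (K.u_unitary _ _)) hw) (K.u_unitary _ _), fun x => ?_⟩
    have h1 : K.α g₁ (K.α s x) = w * K.α s (K.α g₂ x) * star w := by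
      have h2 := hwx x
      change K.α g₁ (K.α s x) * w = w * K.α s (K.α g₂ x) at h2
      rw [← h2, mul_assoc, Unitary.mul_star_self_of_mem hw, mul_one]
    rw [hαu, h1, K.α_mul s g₂]
    simp only [star_mul, star_star, mul_assoc]
  set k := s * g₂ with hk
  have hα1 : ∀ x, K.α 1 x = x := fun x => by rw [K.α_one]; rfl
  have hkk : ∀ x, K.α k (K.α k⁻¹ x) = K.u k k⁻¹ * x * star (K.u k k⁻¹) := fun x => by
    rw [K.α_mul, mul_inv_cancel, hα1]
  have h1 : g₁ * s * k⁻¹ = 1 := by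
    refine K.injective _ ⟨star (K.u (g₁ * s) k⁻¹) * z * K.u k k⁻¹, mul_mem (mul_mem
      (Unitary.star_mem (K.u_unitary _ _)) hz) (K.u_unitary _ _), fun x => ?_⟩
    rw [hαu, hzx, hkk]
    simp only [star_mul, star_star, mul_assoc]
  exact mul_inv_eq_one.1 h1

theorem symbol_gen {g₁ s g₂ : G} (h : g₁ * s = s * g₂) :
    symbol (K.gen g₁ s g₂ h) = K.u g₁ s * star (K.u s g₂) :=
  symbol_eq_of rfl

theorem symbol_gen_mem_unitary {g₁ s g₂ : G} (h : g₁ * s = s * g₂) :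
    symbol (K.gen g₁ s g₂ h) ∈ unitary M.Elt := by
  rw [symbol_gen]
  exact mul_mem (K.u_unitary _ _) (Unitary.star_mem (K.u_unitary _ _))

/-- The coefficient of a bimodule map with respect to `gen`. -/
noncomputable def genCoeff (g₁ s g₂ : G) (h : g₁ * s = s * g₂) : K.TubeHom g₁ s g₂ →ₗ[ℂ] ℂ where
  toFun a := ⟪(K.gen g₁ s g₂ h).1 M.Ω, a.1 M.Ω⟫_ℂ
  map_add' _ _ := inner_add_right _ _ _
  map_smul' _ _ := inner_smul_right _ _ _

theorem genCoeff_gen {g₁ s g₂ : G} (h : g₁ * s = s * g₂) :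
    K.genCoeff g₁ s g₂ h (K.gen g₁ s g₂ h) = 1 := by
  change ⟪(K.gen g₁ s g₂ h).1 M.Ω, (K.gen g₁ s g₂ h).1 M.Ω⟫_ℂ = 1
  rw [← rightMul_symbol, rightMul_Ω, inner_vec,
    Unitary.star_mul_self_of_mem (K.symbol_gen_mem_unitary h)]
  change ⟪M.Ω, M.Ω⟫_ℂ = 1
  rw [inner_self_eq_norm_sq_to_K, M.norm_Ω]
  simp

theorem genCoeff_smul_gen {g₁ s g₂ : G} (h : g₁ * s = s * g₂) (a : K.TubeHom g₁ s g₂) :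
    K.genCoeff g₁ s g₂ h a • K.gen g₁ s g₂ h = a := by
  have hu := K.symbol_gen_mem_unitary h
  set w := symbol (K.gen g₁ s g₂ h) with hw
  have hw' : ∀ x, star w * (K.α g₁ * K.α s) x = (K.α s * K.α g₂) x * star w := fun x => by
    have h := congrArg star (symbol_comm (K.gen g₁ s g₂ h) (star x))
    rwa [star_mul, star_mul, ← map_star, ← map_star, star_star] at h
  obtain ⟨c, hc⟩ := exists_smul_one_of_comm (K.α s * K.α g₂) (star w * symbol a) fun x => by
    rw [mul_assoc, ← symbol_comm, ← mul_assoc, hw', mul_assoc]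
  have ha : a = c • K.gen g₁ s g₂ h := by
    apply symbol_injective
    rw [symbol_smul, ← hw]
    calc symbol a = w * (star w * symbol a) := by
          rw [← mul_assoc, Unitary.mul_star_self_of_mem hu, one_mul]
      _ = c • w := by rw [hc, mul_smul_comm, mul_one]
  rw [ha, map_smul, genCoeff_gen, smul_eq_mul, mul_one]

theorem symbol_tubeMul {g₁ g₂ g₃ s t : G} (b : K.TubeHom g₂ t g₃) (a : K.TubeHom g₁ s g₂) :
    symbol (K.tubeMul b a) =
      K.α g₁ (star (K.u s t)) * symbol a * K.α s (symbol b) * K.u s t := by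
  have hβ : symbol (K.beta s t) = K.u s t := symbol_eq_of rfl
  simp only [tubeMul, symbol_compHom, symbol_tensorHom, symbol_castHom, symbol_idHom,
    symbol_adjHom, hβ, map_one, mul_one, one_mul]

theorem symbol_tubeStar {g₁ g₂ s : G} (a : K.TubeHom g₁ s g₂) :
    symbol (K.tubeStar a) = star (K.obstruction s s⁻¹ s : ℂ) • (star (K.u s⁻¹ s) *
      K.α s⁻¹ (star (symbol a) * K.α g₁ (K.u s s⁻¹))) := by
  have hβ : ∀ s t, symbol (K.beta s t) = K.u s t := fun s t => symbol_eq_of rfl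
  simp only [tubeStar, symbol_compHom, symbol_tensorHom, symbol_castHom, symbol_idHom,
    symbol_adjHom, hβ, map_one, mul_one, one_mul, conjR, conjRbar, symbol_smul, star_smul,
    star_star, map_smul, mul_smul_comm, map_mul, mul_assoc]

theorem tubeMul_smul_left {g₁ g₂ g₃ s t : G} (c : ℂ) (b : K.TubeHom g₂ t g₃)
    (a : K.TubeHom g₁ s g₂) : K.tubeMul (c • b) a = c • K.tubeMul b a :=
  symbol_injective (by
    simp only [symbol_smul, symbol_tubeMul, map_smul, mul_smul_comm, smul_mul_assoc])

theorem tubeMul_smul_right {g₁ g₂ g₃ s t : G} (c : ℂ) (b : K.TubeHom g₂ t g₃)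
    (a : K.TubeHom g₁ s g₂) : K.tubeMul b (c • a) = c • K.tubeMul b a :=
  symbol_injective (by
    simp only [symbol_smul, symbol_tubeMul, mul_smul_comm, smul_mul_assoc])

theorem tubeStar_smul {g₁ g₂ s : G} (c : ℂ) (a : K.TubeHom g₁ s g₂) :
    K.tubeStar (c • a) = star c • K.tubeStar a :=
  symbol_injective (by
    simp only [symbol_smul, symbol_tubeStar, map_smul, mul_smul_comm, smul_mul_assoc, star_smul]
    rw [smul_comm])

theorem star_u_mul_map_u (g₁ g₂ g₃ : G) : star (K.u g₁ g₂) * K.α g₁ (K.u g₂ g₃) =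
    (((K.obstruction g₁ g₂ g₃)⁻¹ : Circle) : ℂ) •
      (K.u (g₁ * g₂) g₃ * star (K.u g₁ (g₂ * g₃))) := by
  have h1 : K.u (g₁ * g₂) g₃ = (K.obstruction g₁ g₂ g₃ : ℂ) •
      (star (K.u g₁ g₂) * (K.α g₁ (K.u g₂ g₃) * K.u g₁ (g₂ * g₃))) := by
    rw [← mul_smul_comm, ← K.obstruction_spec, ← mul_assoc, star_u_mul_u, one_mul]
  rw [h1, smul_mul_assoc, smul_smul, Circle.coe_inv_mul, one_smul]
  simp only [mul_assoc, u_mul_star_u, mul_one]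

theorem star_map_u_mul_u (g₁ g₂ g₃ : G) : K.α g₁ (star (K.u g₂ g₃)) * K.u g₁ g₂ =
    (K.obstruction g₁ g₂ g₃ : ℂ) • (K.u g₁ (g₂ * g₃) * star (K.u (g₁ * g₂) g₃)) := by
  have h := congrArg star (K.star_u_mul_map_u g₁ g₂ g₃)
  rwa [star_mul, star_star, ← map_star, star_smul, star_mul, star_star, Circle.star_coe,
    inv_inv] at h

/-- The scalar in the product of two generators of the tube algebra. -/
noncomputable def mulCoeff (g s t : G) : Circle :=
  K.obstruction g s t * (K.obstruction s (s⁻¹ * g * s) t)⁻¹ *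
    K.obstruction s t ((s * t)⁻¹ * g * (s * t))

theorem mulCoeff_cocycle (g s t k : G) : K.mulCoeff g s t * K.mulCoeff g (s * t) k =
    K.mulCoeff (s⁻¹ * g * s) t k * K.mulCoeff g s (t * k) := by
  have h1 := congrArg Additive.ofMul (K.obstruction_cocycle g s t k)
  have h2 := congrArg Additive.ofMul (K.obstruction_cocycle s (s⁻¹ * g * s) t k)
  have h3 := congrArg Additive.ofMul (K.obstruction_cocycle s t ((s * t)⁻¹ * g * (s * t)) k)
  have h4 := congrArg Additive.ofMul
    (K.obstruction_cocycle s t k ((s * t * k)⁻¹ * g * (s * t * k)))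
  apply Additive.ofMul.injective
  unfold mulCoeff
  simp only [ofMul_mul, ofMul_inv, mul_inv_rev, mul_assoc, mul_inv_cancel_left]
    at h1 h2 h3 h4 ⊢
  linear_combination (norm := module) h1 - h2 + h3 - h4

theorem mulCoeff_one_left (g t : G) : K.mulCoeff g 1 t = 1 := by
  simp [mulCoeff, obstruction_one_left, obstruction_one_mid]

theorem mulCoeff_one_right (g s : G) : K.mulCoeff g s 1 = 1 := by
  simp [mulCoeff, obstruction_one_right, obstruction_one_mid]

theorem tubeMul_gen_gen {g₁ g₂ g₃ s t : G} (h' : g₂ * t = t * g₃) (h : g₁ * s = s * g₂) :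
    K.tubeMul (K.gen g₂ t g₃ h') (K.gen g₁ s g₂ h) = (K.mulCoeff g₁ s t : ℂ) •
      K.gen g₁ (s * t) g₃ (by rw [← mul_assoc, h, mul_assoc, h', mul_assoc]) := by
  have e2 : s⁻¹ * g₁ * s = g₂ := by rw [mul_assoc, h, inv_mul_cancel_left]
  have e3 : (s * t)⁻¹ * g₁ * (s * t) = g₃ := by
    rw [mul_assoc, ← mul_assoc g₁, h, mul_assoc s, h', mul_inv_rev]
    group
  apply symbol_injective
  rw [symbol_smul, symbol_tubeMul, symbol_gen, symbol_gen, symbol_gen, map_mul]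
  have h1 := K.star_map_u_mul_u g₁ s t
  have h2 := K.star_u_mul_map_u s g₂ t
  have h3 := K.star_map_u_mul_u s t g₃
  calc _ = (K.α g₁ (star (K.u s t)) * K.u g₁ s) * (star (K.u s g₂) * K.α s (K.u g₂ t)) *
        (K.α s (star (K.u t g₃)) * K.u s t) := by simp only [mul_assoc]
    _ = _ := by
      rw [h1, h2, h3, h, h']
      simp only [smul_mul_assoc, mul_smul_comm, smul_smul]
      simp only [mul_assoc]
      rw [← mul_assoc (star (K.u (s * g₂) t)), star_u_mul_u, one_mul,
        ← mul_assoc (star (K.u s (t * g₃))), star_u_mul_u, one_mul]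
      congr 1
      rw [mulCoeff, e2, e3]
      push_cast
      ring

theorem map_symbol_tubeStar {g₁ g₂ s : G} (a : K.TubeHom g₁ s g₂) :
    K.α s (symbol (K.tubeStar a)) =
      star (symbol a) * K.α g₁ (K.u s s⁻¹) * star (K.u s s⁻¹) := by
  have h := K.star_map_u_mul_u s s⁻¹ s
  rw [inv_mul_cancel, mul_inv_cancel, u_one_left, u_one_right, star_one, mul_one] at h
  rw [symbol_tubeStar, map_smul, map_mul, K.α_mul, mul_inv_cancel, K.α_one]
  change star _ • (K.α s (star (K.u s⁻¹ s)) *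
    (K.u s s⁻¹ * (star (symbol a) * K.α g₁ (K.u s s⁻¹)) * star (K.u s s⁻¹))) = _
  rw [← mul_assoc, ← mul_assoc, h, smul_mul_assoc, one_mul, smul_mul_assoc, smul_smul,
    Circle.star_coe, Circle.coe_inv_mul, one_smul]

theorem tubeMul_tubeStar_gen {g₁ g₂ s : G} (h : g₁ * s = s * g₂) :
    symbol (K.tubeMul (K.tubeStar (K.gen g₁ s g₂ h)) (K.gen g₁ s g₂ h)) = 1 := by
  rw [symbol_tubeMul, map_symbol_tubeStar]
  have h1 := Unitary.mul_star_self_of_mem (K.symbol_gen_mem_unitary h)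
  set w := symbol (K.gen g₁ s g₂ h)
  calc _ = K.α g₁ (star (K.u s s⁻¹)) * (w * star w) * K.α g₁ (K.u s s⁻¹) *
        (star (K.u s s⁻¹) * K.u s s⁻¹) := by simp only [mul_assoc]
    _ = 1 := by rw [h1, mul_one, ← map_mul, star_u_mul_u, map_one, one_mul]

theorem tubeStar_gen {g₁ g₂ s : G} (h : g₁ * s = s * g₂) :
    K.tubeStar (K.gen g₁ s g₂ h) = (((K.mulCoeff g₁ s s⁻¹)⁻¹ : Circle) : ℂ) •
      K.gen g₂ s⁻¹ g₁ (by rw [eq_inv_mul_iff_mul_eq, ← mul_assoc, ← h, mul_inv_cancel_right]) := by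
  have h' : g₂ * s⁻¹ = s⁻¹ * g₁ := by
    rw [eq_inv_mul_iff_mul_eq, ← mul_assoc, ← h, mul_inv_cancel_right]
  have h1 := K.tubeMul_tubeStar_gen h
  rw [← K.genCoeff_smul_gen h' (K.tubeStar (K.gen g₁ s g₂ h))] at h1 ⊢
  rw [tubeMul_smul_left, tubeMul_gen_gen, smul_smul, symbol_smul, symbol_gen, mul_inv_cancel,
    u_one_left, u_one_right, star_one, mul_one] at h1
  have h2 := smul_unitary_cancel (one_mem (unitary M.Elt)) (h1.trans (one_smul ℂ _).symm)
  rw [Circle.coe_inv, eq_inv_of_mul_eq_one_left h2]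

end GKernel

namespace GKernel

open II1Factor

variable {H : Type*} [NormedAddCommGroup H] [InnerProductSpace ℂ H] [CompleteSpace H]
  {M : II1Factor H} {G : Type*} [Group G] (K : GKernel M G)

theorem tubeOf_smul {g₁ s g₂ : G} (c : ℂ) (a : K.TubeHom g₁ s g₂) :
    K.tubeOf g₁ s g₂ (c • a) = c • K.tubeOf g₁ s g₂ a := by
  classical
  exact map_smul (DirectSum.lof ℂ _ (fun p : G × G × G => K.TubeHom p.1 p.2.1 p.2.2) (g₁, s, g₂))
    c a

theorem tube_induction {p : K.Tube → Prop} (zero : p 0)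
    (of : ∀ g₁ s g₂ a, p (K.tubeOf g₁ s g₂ a)) (add : ∀ x y, p x → p y → p (x + y))
    (x : K.Tube) : p x := by
  classical
  exact DirectSum.induction_on x zero (fun i a => of i.1 i.2.1 i.2.2 a) add

instance : IsScalarTower ℂ K.Tube K.Tube := ⟨fun c x y => by
  change (c • x) * y = c • (x * y)
  induction x using K.tube_induction with
  | zero => simp
  | add x x' hx hx' => rw [smul_add, add_mul, hx, hx', add_mul, smul_add]
  | of g₂ t g₃ b =>
    induction y using K.tube_induction with
    | zero => simp
    | add y y' hy hy' => rw [mul_add, hy, hy', mul_add, smul_add]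
    | of g₁ s g₂' a =>
      rw [← tubeOf_smul]
      by_cases h : g₂' = g₂
      · subst h
        rw [tubeOf_mul_tubeOf, tubeOf_mul_tubeOf, tubeMul_smul_left, tubeOf_smul]
      · rw [K.tubeOf_mul_tubeOf_of_ne h, K.tubeOf_mul_tubeOf_of_ne h, smul_zero]⟩

instance : SMulCommClass ℂ K.Tube K.Tube := ⟨fun c x y => by
  change c • (x * y) = x * (c • y)
  induction x using K.tube_induction with
  | zero => simp
  | add x x' hx hx' => rw [add_mul, smul_add, hx, hx', add_mul]
  | of g₂ t g₃ b =>
    induction y using K.tube_induction with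
    | zero => simp
    | add y y' hy hy' => rw [smul_add, mul_add, smul_add, hy, hy', mul_add]
    | of g₁ s g₂' a =>
      rw [← tubeOf_smul]
      by_cases h : g₂' = g₂
      · subst h
        rw [tubeOf_mul_tubeOf, tubeOf_mul_tubeOf, tubeMul_smul_right, tubeOf_smul]
      · rw [K.tubeOf_mul_tubeOf_of_ne h, K.tubeOf_mul_tubeOf_of_ne h, smul_zero]⟩

theorem tube_star_add (x y : K.Tube) : star (x + y) = star x + star y :=
  map_add K.tubeStarHom x y

theorem tube_star_zero : star (0 : K.Tube) = 0 := map_zero K.tubeStarHom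

instance : StarModule ℂ K.Tube := ⟨fun c x => by
  induction x using K.tube_induction with
  | zero => rw [smul_zero, tube_star_zero, smul_zero]
  | add x y hx hy => rw [smul_add, tube_star_add, hx, hy, tube_star_add, smul_add]
  | of g₁ s g₂ a => rw [← tubeOf_smul, star_tubeOf, star_tubeOf, tubeStar_smul, tubeOf_smul]⟩

/-- The element `a(g, s, s⁻¹ g s)` of the tube algebra. -/
noncomputable def arrow (g s : G) : K.Tube :=
  K.tubeOf g s (s⁻¹ * g * s) (K.gen g s (s⁻¹ * g * s) (by group))

theorem tubeOf_gen {g₁ s g₂ : G} (h : g₁ * s = s * g₂) :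
    K.tubeOf g₁ s g₂ (K.gen g₁ s g₂ h) = K.arrow g₁ s := by
  obtain rfl : g₂ = s⁻¹ * g₁ * s := by rw [mul_assoc, h, inv_mul_cancel_left]
  rfl

theorem tubeProj_eq_arrow (g : G) : K.tubeProj g = K.arrow g 1 := K.tubeOf_gen _

theorem arrow_mul_arrow (g s t : G) : K.arrow (s⁻¹ * g * s) t * K.arrow g s =
    (K.mulCoeff g s t : ℂ) • K.arrow g (s * t) := by
  rw [arrow, arrow, tubeOf_mul_tubeOf, tubeMul_gen_gen, tubeOf_smul, tubeOf_gen]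

theorem arrow_mul_arrow_of_ne {g s h t : G} (hne : s⁻¹ * g * s ≠ h) :
    K.arrow h t * K.arrow g s = 0 := K.tubeOf_mul_tubeOf_of_ne hne _ _

theorem star_arrow (g s : G) : star (K.arrow g s) =
    (((K.mulCoeff g s s⁻¹)⁻¹ : Circle) : ℂ) • K.arrow (s⁻¹ * g * s) s⁻¹ := by
  rw [arrow, star_tubeOf, tubeStar_gen, tubeOf_smul, tubeOf_gen]

open Classical in
/-- The coordinates of an element of the tube algebra with respect to the elements `arrow g s`. -/
noncomputable def tubeCoord : K.Tube →ₗ[ℂ] (G × G →₀ ℂ) :=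
  DirectSum.toModule ℂ (G × G × G) (G × G →₀ ℂ) fun p =>
    if h : p.1 * p.2.1 = p.2.1 * p.2.2 then
      (Finsupp.lsingle (p.1, p.2.1)).comp (K.genCoeff p.1 p.2.1 p.2.2 h) else 0

theorem tubeCoord_arrow (g s : G) : K.tubeCoord (K.arrow g s) = Finsupp.single (g, s) 1 := by
  classical
  have h := DirectSum.toModule_lof ℂ (M := fun p : G × G × G => K.TubeHom p.1 p.2.1 p.2.2)
    (φ := fun p => if h : p.1 * p.2.1 = p.2.1 * p.2.2 then
      (Finsupp.lsingle (p.1, p.2.1)).comp (K.genCoeff p.1 p.2.1 p.2.2 h) else 0)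
    (g, s, s⁻¹ * g * s) (K.gen g s (s⁻¹ * g * s) (by group))
  refine h.trans ?_
  rw [dif_pos (by group)]
  simp [genCoeff_gen]

/-- The basis of the tube algebra of the elements `arrow g s`. -/
noncomputable def tubeBasis : Module.Basis (G × G) ℂ K.Tube :=
  .ofRepr (LinearEquiv.ofLinearMap K.tubeCoord
    (Finsupp.linearCombination ℂ fun q : G × G => K.arrow q.1 q.2)
    (by
      ext1 q
      ext1
      simp [tubeCoord_arrow])
    (by
      ext x
      change Finsupp.linearCombination ℂ (fun q : G × G => K.arrow q.1 q.2) (K.tubeCoord x) = x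
      induction x using K.tube_induction with
      | zero => simp
      | add x y hx hy => rw [map_add, map_add, hx, hy]
      | of g₁ s g₂ a =>
        by_cases h : g₁ * s = s * g₂
        · rw [← K.genCoeff_smul_gen h a, tubeOf_smul, tubeOf_gen, map_smul, map_smul,
            tubeCoord_arrow, Finsupp.linearCombination_single, one_smul]
        · obtain rfl : a = 0 := by
            by_contra ha
            exact h (K.eq_of_tubeHom_ne_zero ha)
          have h0 : K.tubeOf g₁ s g₂ 0 = 0 := map_zero (K.sumOf g₁ s g₂)
          rw [h0, map_zero, map_zero]))

theorem tubeBasis_apply (q : G × G) : K.tubeBasis q = K.arrow q.1 q.2 := by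
  rw [tubeBasis, Module.Basis.coe_ofRepr]
  simp

theorem arrow_induction {p : K.Tube → Prop} (zero : p 0)
    (arrow : ∀ g s (c : ℂ), p (c • K.arrow g s)) (add : ∀ x y, p x → p y → p (x + y))
    (x : K.Tube) : p x := by
  rw [← K.tubeBasis.linearCombination_repr x, Finsupp.linearCombination_apply]
  refine Finset.sum_induction _ p add zero fun q _ => ?_
  change p (_ • K.tubeBasis q)
  rw [tubeBasis_apply]
  exact arrow _ _ _

noncomputable instance : NonUnitalRing K.Tube where
  mul_assoc x y z := by
    induction x using K.arrow_induction with
    | zero => simp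
    | add x x' hx hx' => rw [add_mul, add_mul, hx, hx', add_mul]
    | arrow k r c =>
    induction y using K.arrow_induction with
    | zero => simp
    | add y y' hy hy' => rw [mul_add, add_mul, hy, hy', add_mul, mul_add]
    | arrow h t d =>
    induction z using K.arrow_induction with
    | zero => simp
    | add z z' hz hz' => rw [mul_add, hz, hz', mul_add, mul_add]
    | arrow g s e =>
    simp only [smul_mul_assoc, mul_smul_comm]
    congr 3
    by_cases h1 : s⁻¹ * g * s = h
    · subst h1
      rw [arrow_mul_arrow, mul_smul_comm]
      by_cases h2 : t⁻¹ * (s⁻¹ * g * s) * t = k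
      · subst h2
        rw [arrow_mul_arrow, smul_mul_assoc, arrow_mul_arrow]
        have h3 : t⁻¹ * (s⁻¹ * g * s) * t = (s * t)⁻¹ * g * (s * t) := by group
        rw [h3, arrow_mul_arrow, smul_smul, smul_smul, ← Circle.coe_mul, ← Circle.coe_mul,
          ← mulCoeff_cocycle, mul_assoc]
      · rw [K.arrow_mul_arrow_of_ne h2, K.arrow_mul_arrow_of_ne, zero_mul, smul_zero]
        convert h2 using 1
        group
    · rw [K.arrow_mul_arrow_of_ne h1, mul_zero]
      by_cases h2 : t⁻¹ * h * t = k
      · subst h2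
        rw [arrow_mul_arrow, smul_mul_assoc, K.arrow_mul_arrow_of_ne h1, smul_zero]
      · rw [K.arrow_mul_arrow_of_ne h2, zero_mul]

noncomputable instance : StarRing K.Tube where
  star_involutive x := by
    induction x using K.arrow_induction with
    | zero => rw [tube_star_zero, tube_star_zero]
    | add x y hx hy => rw [tube_star_add, tube_star_add, hx, hy]
    | arrow g s c =>
      have h := K.mulCoeff_cocycle g s s⁻¹ s
      rw [mul_inv_cancel, inv_mul_cancel, mulCoeff_one_left, mulCoeff_one_right, mul_one,
        mul_one] at h
      have h' : (s⁻¹)⁻¹ * (s⁻¹ * g * s) * s⁻¹ = g := by group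
      rw [star_smul, star_smul, star_star, star_arrow, star_smul, star_arrow, Circle.star_coe_inv,
        smul_smul, smul_smul, h', inv_inv, h, mul_assoc, Circle.coe_mul_inv, mul_one]
  star_add := K.tube_star_add
  star_mul x y := by
    induction x using K.arrow_induction with
    | zero => rw [zero_mul, tube_star_zero, mul_zero]
    | add x x' hx hx' => rw [add_mul, tube_star_add, hx, hx', tube_star_add, mul_add]
    | arrow h t d =>
    induction y using K.arrow_induction with
    | zero => rw [mul_zero, tube_star_zero, zero_mul]
    | add y y' hy hy' => rw [mul_add, tube_star_add, hy, hy', tube_star_add, add_mul]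
    | arrow g s e =>
    simp only [smul_mul_assoc, mul_smul_comm, star_smul, star_arrow, smul_smul]
    by_cases h1 : s⁻¹ * g * s = h
    · subst h1
      have h2 : s⁻¹ * g * s = (t⁻¹)⁻¹ * (t⁻¹ * (s⁻¹ * g * s) * t) * t⁻¹ := by group
      have h3 : K.arrow (s⁻¹ * g * s) s⁻¹ * K.arrow (t⁻¹ * (s⁻¹ * g * s) * t) t⁻¹ =
          (K.mulCoeff (t⁻¹ * (s⁻¹ * g * s) * t) t⁻¹ s⁻¹ : ℂ) •
            K.arrow (t⁻¹ * (s⁻¹ * g * s) * t) (t⁻¹ * s⁻¹) := by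
        conv_lhs => rw [h2]
        rw [← arrow_mul_arrow]
        congr 3
        group
      rw [arrow_mul_arrow, star_smul, star_arrow, h3, Circle.star_coe]
      have h4 := K.mulCoeff_cocycle g s t (s * t)⁻¹
      have h5 := K.mulCoeff_cocycle (s⁻¹ * g * s) t t⁻¹ s⁻¹
      have h6 : (s * t)⁻¹ * g * (s * t) = t⁻¹ * (s⁻¹ * g * s) * t := by group
      rw [h6]
      rw [mul_inv_cancel, mulCoeff_one_left, mul_one] at h5
      rw [mul_inv_rev, mul_inv_cancel_left] at h4
      rw [mul_inv_rev, smul_smul, smul_smul, smul_smul]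
      congr 1
      have h7 : (K.mulCoeff g s t)⁻¹ * (K.mulCoeff g (s * t) (t⁻¹ * s⁻¹))⁻¹ =
          (K.mulCoeff (s⁻¹ * g * s) t t⁻¹)⁻¹ * (K.mulCoeff g s s⁻¹)⁻¹ *
            K.mulCoeff (t⁻¹ * (s⁻¹ * g * s) * t) t⁻¹ s⁻¹ := by
        rw [← mul_inv, h4, h5, mul_inv]
        apply Additive.ofMul.injective
        simp only [ofMul_mul, ofMul_inv]
        module
      have h8 := congrArg (fun z : Circle => (z : ℂ)) h7
      simp only [Circle.coe_mul] at h8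
      rw [star_mul]
      linear_combination (star d * star e) * h8
    · rw [K.arrow_mul_arrow_of_ne h1, tube_star_zero, smul_zero, K.arrow_mul_arrow_of_ne, smul_zero]
      intro h2
      apply h1
      rw [← h2]
      group

end GKernel

/-! ## Matrix units of the sum of matrix algebras over twisted group algebras -/

theorem FinMatrix.star_E {ι : Type*} (i j : ι) : star (FinMatrix.E i j) = FinMatrix.E j i := by
  change Finsupp.mapRange star (star_zero ℂ) (Finsupp.equivMapDomain (Equiv.prodComm ι ι)
    (Finsupp.single (i, j) (1 : ℂ))) = Finsupp.single (j, i) (1 : ℂ)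
  rw [Finsupp.equivMapDomain_single, Finsupp.mapRange_single, star_one]
  rfl

theorem TwistedGroupAlgebra.star_basisElt {L : Type*} [Group L] (φ : TwoCocycle L) (s : L) :
    star (basisElt φ s) = (((φ.toFun s⁻¹ s)⁻¹ : Circle) : ℂ) • basisElt φ s⁻¹ := by
  classical
  refine ext_coeff fun t => ?_
  rw [coeff_star]
  change _ * star (DFunLike.coe (F := L →₀ ℂ) (Finsupp.single s 1) t⁻¹) =
    _ * DFunLike.coe (F := L →₀ ℂ) (Finsupp.single s⁻¹ 1) t
  rw [Finsupp.single_apply, Finsupp.single_apply]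
  by_cases h : t = s⁻¹
  · subst h
    simp only [inv_inv, if_true, star_one, mul_one]
    exact Circle.star_coe _
  · rw [if_neg, if_neg (Ne.symm h), star_zero, mul_zero, mul_zero]
    intro h1
    exact h (by rw [h1, inv_inv])

namespace AlgSum

variable {ι : Type*} (A : ι → Type*) [∀ i, NonUnitalNonAssocRing (A i)]

open Classical in
/-- The inclusion of a summand. -/
noncomputable def of (i : ι) (a : A i) : AlgSum A := DFinsupp.single i a

theorem of_mul_of (i : ι) (a b : A i) : of A i a * of A i b = of A i (a * b) := by
  classical
  refine DFinsupp.ext fun j => ?_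
  change (DFinsupp.single i a) j * (DFinsupp.single i b) j = (DFinsupp.single i (a * b)) j
  by_cases h : i = j
  · subst h
    simp
  · rw [DFinsupp.single_eq_of_ne (Ne.symm h), zero_mul,
      DFinsupp.single_eq_of_ne (Ne.symm h)]

theorem of_mul_of_ne {i j : ι} (h : i ≠ j) (a : A i) (b : A j) : of A i a * of A j b = 0 := by
  classical
  refine DFinsupp.ext fun k => ?_
  change (DFinsupp.single i a) k * (DFinsupp.single j b) k = 0
  by_cases h1 : i = k
  · subst h1
    rw [DFinsupp.single_eq_of_ne (i := j) h, mul_zero]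
  · rw [DFinsupp.single_eq_of_ne (i := i) (Ne.symm h1), zero_mul]

theorem of_smul [∀ i, Module ℂ (A i)] (i : ι) (c : ℂ) (a : A i) :
    of A i (c • a) = c • of A i a := by
  classical
  exact DFinsupp.single_smul c a

theorem of_zero (i : ι) : of A i 0 = 0 := by
  classical
  exact DFinsupp.single_zero i

theorem star_of [∀ i, StarAddMonoid (A i)] (i : ι) (a : A i) :
    star (of A i a) = of A i (star a) := by
  classical
  exact DFinsupp.mapRange_single

theorem star_add' [∀ i, StarAddMonoid (A i)] (x y : AlgSum A) :
    star (x + y) = star x + star y := DFinsupp.ext fun _ => star_add _ _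

instance [∀ i, Module ℂ (A i)] [∀ i, StarAddMonoid (A i)] [∀ i, StarModule ℂ (A i)] :
    StarModule ℂ (AlgSum A) := ⟨fun c _ => DFinsupp.ext fun _ => star_smul c _⟩

instance [∀ i, Module ℂ (A i)] [∀ i, IsScalarTower ℂ (A i) (A i)] :
    IsScalarTower ℂ (AlgSum A) (AlgSum A) := ⟨fun c _ _ => DFinsupp.ext fun _ =>
      smul_mul_assoc c _ _⟩

instance [∀ i, Module ℂ (A i)] [∀ i, SMulCommClass ℂ (A i) (A i)] :
    SMulCommClass ℂ (AlgSum A) (AlgSum A) := ⟨fun c _ _ => DFinsupp.ext fun _ =>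
      (mul_smul_comm c _ _).symm⟩

variable {A} in
/-- The basis of a direct sum given by bases of the summands. -/
noncomputable def basis [∀ i, Module ℂ (A i)] {κ : ι → Type*}
    (b : ∀ i, Module.Basis (κ i) ℂ (A i)) : Module.Basis (Σ i, κ i) ℂ (AlgSum A) :=
  DFinsupp.basis b

variable {A} in
theorem basis_apply [∀ i, Module ℂ (A i)] {κ : ι → Type*}
    (b : ∀ i, Module.Basis (κ i) ℂ (A i)) (p : Σ i, κ i) : basis b p = of A p.1 (b p.1 p.2) := by
  classical
  apply (basis b).repr.injective
  rw [Module.Basis.repr_self]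
  ext ⟨j, l⟩
  change _ = (b j).repr ((DFinsupp.single p.1 (b p.1 p.2)) j) l
  by_cases h : p.1 = j
  · obtain ⟨i, k⟩ := p
    change i = j at h
    subst h
    simp [Finsupp.single_apply]
  · rw [DFinsupp.single_eq_of_ne (Ne.symm h), map_zero, Finsupp.single_eq_of_ne]
    · rfl
    · rintro rfl
      exact h rfl

end AlgSum

theorem basis_smul_induction {ι A : Type*} [AddCommGroup A] [Module ℂ A] (a : Module.Basis ι ℂ A)
    {p : A → Prop} (zero : p 0) (basis : ∀ i (c : ℂ), p (c • a i))
    (add : ∀ x y, p x → p y → p (x + y)) (x : A) : p x := by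
  rw [← a.linearCombination_repr x, Finsupp.linearCombination_apply]
  exact Finset.sum_induction _ p add zero fun i _ => basis i _

theorem map_mul_of_basis {ι A B : Type*} [NonUnitalNonAssocRing A]
    [NonUnitalNonAssocRing B] [Module ℂ A] [Module ℂ B] [IsScalarTower ℂ A A] [SMulCommClass ℂ A A]
    [IsScalarTower ℂ B B] [SMulCommClass ℂ B B] (a : Module.Basis ι ℂ A) (f : A →ₗ[ℂ] B)
    (hmul : ∀ i j, f (a i * a j) = f (a i) * f (a j)) (x y : A) : f (x * y) = f x * f y := by
  induction x using basis_smul_induction a with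
  | zero => simp
  | add x x' hx hx' => rw [add_mul, map_add, hx, hx', map_add, add_mul]
  | basis i c =>
    induction y using basis_smul_induction a with
    | zero => simp
    | add y y' hy hy' => rw [mul_add, map_add, hy, hy', map_add, mul_add]
    | basis j d => simp only [smul_mul_assoc, mul_smul_comm, map_smul, hmul]

theorem map_star_of_basis {ι A B : Type*} [AddCommGroup A] [AddCommGroup B] [Module ℂ A]
    [Module ℂ B] [Star A] [Star B] [StarModule ℂ A] [StarModule ℂ B]
    (hA : ∀ x y : A, star (x + y) = star x + star y)
    (hB : ∀ x y : B, star (x + y) = star x + star y)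
    (a : Module.Basis ι ℂ A) (f : A →ₗ[ℂ] B)
    (hstar : ∀ i, f (star (a i)) = star (f (a i))) (x : A) : f (star x) = star (f x) := by
  have hA0 : star (0 : A) = 0 := by simpa using hA 0 0
  have hB0 : star (0 : B) = 0 := by simpa using hB 0 0
  induction x using basis_smul_induction a with
  | zero => rw [hA0, map_zero, hB0]
  | add x x' hx hx' => rw [hA, map_add, hx, hx', map_add, hB]
  | basis i c => rw [star_smul, map_smul, map_smul, star_smul, hstar]

namespace GKernel

open II1Factor

variable {H : Type*} [NormedAddCommGroup H] [InnerProductSpace ℂ H] [CompleteSpace H]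
  {M : II1Factor H} {G : Type*} [Group G] (K : GKernel M G) (r : ConjClasses G → G)

/-- The centralizer of the representative of a class. -/
abbrev Cent (C : ConjClasses G) : Type _ := Subgroup.centralizer ({r C} : Set G)

/-- The index set of the matrix units. -/
abbrev UnitIndex : Type _ :=
  Σ C : ConjClasses G, (C.carrier × C.carrier) × Cent r C

/-- The matrix unit `E_{xy} ⊗ [s]` in the summand of `C`. -/
noncomputable def classUnit (C : ConjClasses G) (x y : C.carrier) (s : Cent r C) :
    K.ClassAlgebra r :=
  AlgSum.of _ C (FinMatrix.E x y ⊗ₜ TwistedGroupAlgebra.basisElt (K.phiC (r C)) s)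

theorem classUnit_mul (C : ConjClasses G) (x y z : C.carrier) (s t : Cent r C) :
    K.classUnit r C x y s * K.classUnit r C y z t =
      ((K.phiC (r C)).toFun s t : ℂ) • K.classUnit r C x z (s * t) := by
  rw [classUnit, classUnit, AlgSum.of_mul_of, Algebra.TensorProduct.tmul_mul_tmul,
    FinMatrix.E_mul_E, TwistedGroupAlgebra.basisElt_mul_basisElt, TensorProduct.tmul_smul,
    AlgSum.of_smul]
  rfl

theorem classUnit_mul_of_ne {C D : ConjClasses G} {x y : C.carrier} {z t : D.carrier}
    (h : (y : G) ≠ z) (s : Cent r C) (s' : Cent r D) :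
    K.classUnit r C x y s * K.classUnit r D z t s' = 0 := by
  by_cases hCD : C = D
  · subst hCD
    rw [classUnit, classUnit, AlgSum.of_mul_of, Algebra.TensorProduct.tmul_mul_tmul,
      FinMatrix.E_mul_E_of_ne _ _ (fun h' => h (congrArg Subtype.val h')), TensorProduct.zero_tmul]
    exact AlgSum.of_zero _ C
  · exact AlgSum.of_mul_of_ne _ hCD _ _

theorem star_classUnit (C : ConjClasses G) (x y : C.carrier) (s : Cent r C) :
    star (K.classUnit r C x y s) =
      ((((K.phiC (r C)).toFun s⁻¹ s)⁻¹ : Circle) : ℂ) • K.classUnit r C y x s⁻¹ := by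
  rw [classUnit, AlgSum.star_of, TensorProduct.star_tmul, FinMatrix.star_E,
    TwistedGroupAlgebra.star_basisElt, TensorProduct.tmul_smul, AlgSum.of_smul]
  rfl

/-- The basis of matrix units. -/
noncomputable def classBasis : Module.Basis (UnitIndex r) ℂ (K.ClassAlgebra r) :=
  AlgSum.basis fun C =>
    Module.Basis.tensorProduct
      (.ofRepr (LinearEquiv.refl ℂ (C.carrier × C.carrier →₀ ℂ)) :
        Module.Basis (C.carrier × C.carrier) ℂ (FinMatrix C.carrier))
      (.ofRepr (LinearEquiv.refl ℂ (Cent r C →₀ ℂ)) :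
        Module.Basis (Cent r C) ℂ (TwistedGroupAlgebra (K.phiC (r C))))

theorem classBasis_apply (i : UnitIndex r) :
    K.classBasis r i = K.classUnit r i.1 i.2.1.1 i.2.1.2 i.2.2 := by
  rw [classBasis, AlgSum.basis_apply, Module.Basis.tensorProduct_apply']
  rfl

variable {r}

theorem exists_conjugator (hr : ∀ C, ConjClasses.mk (r C) = C) (C : ConjClasses G) (x : C.carrier) : ∃ k : G, k⁻¹ * r C * k = x := by
  obtain ⟨x, hx⟩ := x
  have h : ConjClasses.mk (r C) = ConjClasses.mk x := by
    rw [hr, ConjClasses.mem_carrier_iff_mk_eq.1 hx]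
  obtain ⟨k, hk⟩ := isConj_iff.1 (ConjClasses.mk_eq_mk_iff_isConj.1 h)
  exact ⟨k⁻¹, by rw [inv_inv, hk]⟩

variable (hr : ∀ C, ConjClasses.mk (r C) = C)

open Classical in
/-- An element conjugating the representative of `C` to `x`, trivial if `x` is the representative. -/
noncomputable def conjugator (C : ConjClasses G) (x : C.carrier) : G :=
  if (x : G) = r C then 1 else (exists_conjugator hr C x).choose

theorem conjugator_spec (C : ConjClasses G) (x : C.carrier) :
    (conjugator hr C x)⁻¹ * r C * conjugator hr C x = x := by
  unfold conjugator
  split_ifs with h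
  · rw [inv_one, one_mul, mul_one, h]
  · exact (exists_conjugator hr C x).choose_spec

theorem conjugator_spec' (C : ConjClasses G) (x : C.carrier) :
    ((conjugator hr C x)⁻¹)⁻¹ * x * (conjugator hr C x)⁻¹ = r C := by
  rw [← conjugator_spec hr C x]
  group

theorem arrow_mul_arrow' {g h s : G} (hg : s⁻¹ * g * s = h) (t : G) :
    K.arrow h t * K.arrow g s = (K.mulCoeff g s t : ℂ) • K.arrow g (s * t) := by
  subst hg
  exact K.arrow_mul_arrow g s t

/-- A partial isometry from the `r C`-th to the `x`-th space. -/
noncomputable def tubeIso (C : ConjClasses G) (x : C.carrier) : K.Tube :=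
  K.arrow (r C) (conjugator hr C x)

theorem tubeIso_of_eq (C : ConjClasses G) (x : C.carrier) (hx : (x : G) = r C) :
    K.tubeIso hr C x = K.arrow (r C) 1 := by
  rw [tubeIso, conjugator, if_pos hx]

theorem star_tubeIso (C : ConjClasses G) (x : C.carrier) : star (K.tubeIso hr C x) =
    (((K.mulCoeff (r C) (conjugator hr C x) (conjugator hr C x)⁻¹)⁻¹ : Circle) : ℂ) •
      K.arrow x (conjugator hr C x)⁻¹ := by
  rw [tubeIso, star_arrow, conjugator_spec]

theorem star_tubeIso_mul_tubeIso (C : ConjClasses G) (x : C.carrier) :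
    star (K.tubeIso hr C x) * K.tubeIso hr C x = K.arrow (r C) 1 := by
  rw [star_tubeIso, tubeIso, smul_mul_assoc, K.arrow_mul_arrow' (conjugator_spec hr C x), smul_smul,
    Circle.coe_inv_mul, one_smul, mul_inv_cancel]

theorem tubeIso_mul_star_tubeIso (C : ConjClasses G) (x : C.carrier) :
    K.tubeIso hr C x * star (K.tubeIso hr C x) = K.arrow x 1 := by
  have h := K.mulCoeff_cocycle (r C) (conjugator hr C x) (conjugator hr C x)⁻¹ (conjugator hr C x)
  rw [mul_inv_cancel, inv_mul_cancel, mulCoeff_one_left, mulCoeff_one_right, mul_one, mul_one,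
    conjugator_spec] at h
  rw [star_tubeIso, tubeIso, mul_smul_comm, K.arrow_mul_arrow' (conjugator_spec' hr C x), smul_smul,
    h, Circle.coe_inv_mul, one_smul, inv_mul_cancel]

theorem star_tubeIso_mul_tubeIso_of_ne {C D : ConjClasses G} {x : C.carrier} {y : D.carrier}
    (h : (x : G) ≠ y) : star (K.tubeIso hr C x) * K.tubeIso hr D y = 0 := by
  rw [star_tubeIso, tubeIso, smul_mul_assoc, K.arrow_mul_arrow_of_ne, smul_zero]
  rw [conjugator_spec]
  exact h.symm

variable (r) in
/-- The basis element `[s]` in the corner of the representative of `C`. -/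
noncomputable def cornerElt (C : ConjClasses G) (s : Cent r C) : K.Tube := K.arrow (r C) (s : G)⁻¹

theorem cent_conj (C : ConjClasses G) (s : Cent r C) : ((s : G)⁻¹)⁻¹ * r C * (s : G)⁻¹ = r C := by
  have h := Subgroup.mem_centralizer_iff.1 s.2 (r C) rfl
  rw [inv_inv, ← h, mul_inv_cancel_right]

theorem phiC_apply (C : ConjClasses G) (s t : Cent r C) :
    (K.phiC (r C)).toFun s t = K.mulCoeff (r C) (t : G)⁻¹ (s : G)⁻¹ := by
  have h1 := cent_conj C t
  have h2 : ((t : G)⁻¹ * (s : G)⁻¹)⁻¹ * r C * ((t : G)⁻¹ * (s : G)⁻¹) = r C := by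
    have h := cent_conj C (s * t)
    rwa [Subgroup.coe_mul, mul_inv_rev] at h
  change (K.phi _ _ _)⁻¹ = _
  rw [mulCoeff, h1, h2, phi]
  simp only [mul_inv_rev, inv_inv]
  apply Additive.ofMul.injective
  simp only [ofMul_mul, ofMul_inv]
  abel

theorem cornerElt_mul (C : ConjClasses G) (s t : Cent r C) :
    K.cornerElt r C s * K.cornerElt r C t =
      ((K.phiC (r C)).toFun s t : ℂ) • K.cornerElt r C (s * t) := by
  rw [cornerElt, cornerElt, K.arrow_mul_arrow' (cent_conj C t), phiC_apply, cornerElt,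
    Subgroup.coe_mul, mul_inv_rev]

theorem cornerElt_one (C : ConjClasses G) : K.cornerElt r C 1 = K.arrow (r C) 1 := by
  rw [cornerElt, Subgroup.coe_one, inv_one]

theorem star_cornerElt (C : ConjClasses G) (s : Cent r C) : star (K.cornerElt r C s) =
    ((((K.phiC (r C)).toFun s⁻¹ s)⁻¹ : Circle) : ℂ) • K.cornerElt r C s⁻¹ := by
  rw [cornerElt, star_arrow, cent_conj, phiC_apply, cornerElt, Subgroup.coe_inv]

theorem arrow_one_mul_cornerElt (C : ConjClasses G) (s : Cent r C) :
    K.arrow (r C) 1 * K.cornerElt r C s = K.cornerElt r C s := by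
  rw [← cornerElt_one, cornerElt_mul, (K.phiC (r C)).one_left, one_mul, Circle.coe_one, one_smul]

/-- The matrix units of the tube algebra. -/
noncomputable def tubeUnit (C : ConjClasses G) (x y : C.carrier) (s : Cent r C) : K.Tube :=
  K.tubeIso hr C x * K.cornerElt r C s * star (K.tubeIso hr C y)

theorem tubeUnit_mul (C : ConjClasses G) (x y z : C.carrier) (s t : Cent r C) :
    K.tubeUnit hr C x y s * K.tubeUnit hr C y z t =
      ((K.phiC (r C)).toFun s t : ℂ) • K.tubeUnit hr C x z (s * t) := by
  calc _ = K.tubeIso hr C x * (K.cornerElt r C s * ((star (K.tubeIso hr C y) * K.tubeIso hr C y) *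
        K.cornerElt r C t)) * star (K.tubeIso hr C z) := by simp only [tubeUnit, mul_assoc]
    _ = _ := by
      rw [star_tubeIso_mul_tubeIso, arrow_one_mul_cornerElt, cornerElt_mul, mul_smul_comm,
        smul_mul_assoc, tubeUnit]

theorem tubeUnit_mul_of_ne {C D : ConjClasses G} {x y : C.carrier} {z t : D.carrier}
    (h : (y : G) ≠ z) (s : Cent r C) (s' : Cent r D) :
    K.tubeUnit hr C x y s * K.tubeUnit hr D z t s' = 0 := by
  calc _ = K.tubeIso hr C x * K.cornerElt r C s * ((star (K.tubeIso hr C y) * K.tubeIso hr D z) *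
        (K.cornerElt r D s' * star (K.tubeIso hr D t))) := by simp only [tubeUnit, mul_assoc]
    _ = _ := by rw [K.star_tubeIso_mul_tubeIso_of_ne hr h, zero_mul, mul_zero]

theorem star_tubeUnit (C : ConjClasses G) (x y : C.carrier) (s : Cent r C) :
    star (K.tubeUnit hr C x y s) =
      ((((K.phiC (r C)).toFun s⁻¹ s)⁻¹ : Circle) : ℂ) • K.tubeUnit hr C y x s⁻¹ := by
  rw [tubeUnit, star_mul, star_mul, star_star, star_cornerElt, smul_mul_assoc, mul_smul_comm,
    tubeUnit, mul_assoc]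

theorem tubeUnit_one (C : ConjClasses G) (x : C.carrier) :
    K.tubeUnit hr C x x 1 = K.arrow x 1 := by
  rw [tubeUnit, cornerElt_one, tubeIso, arrow_mul_arrow' _ (by group), one_mul, mulCoeff_one_left,
    Circle.coe_one, one_smul]
  exact K.tubeIso_mul_star_tubeIso hr C x

theorem exists_tubeUnit_eq (C : ConjClasses G) (x y : C.carrier) (s : Cent r C) :
    ∃ c : Circle, K.tubeUnit hr C x y s =
      (c : ℂ) • K.arrow y ((conjugator hr C y)⁻¹ * (s : G)⁻¹ * conjugator hr C x) := by
  refine ⟨(K.mulCoeff (r C) (conjugator hr C y) (conjugator hr C y)⁻¹)⁻¹ *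
    K.mulCoeff y (conjugator hr C y)⁻¹ (s : G)⁻¹ *
    K.mulCoeff y ((conjugator hr C y)⁻¹ * (s : G)⁻¹) (conjugator hr C x), ?_⟩
  have h : ((conjugator hr C y)⁻¹ * (s : G)⁻¹)⁻¹ * y * ((conjugator hr C y)⁻¹ * (s : G)⁻¹) =
      r C := by
    have h1 : ((conjugator hr C y)⁻¹ * (s : G)⁻¹)⁻¹ * y * ((conjugator hr C y)⁻¹ * (s : G)⁻¹) =
        ((s : G)⁻¹)⁻¹ * (((conjugator hr C y)⁻¹)⁻¹ * y * (conjugator hr C y)⁻¹) * (s : G)⁻¹ := by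
      group
    rw [h1, conjugator_spec', cent_conj]
  rw [tubeUnit, mul_assoc, star_tubeIso, mul_smul_comm, cornerElt,
    K.arrow_mul_arrow' (conjugator_spec' hr C y), mul_smul_comm, mul_smul_comm, tubeIso,
    K.arrow_mul_arrow' h, smul_smul, smul_smul, Circle.coe_mul, Circle.coe_mul]

/-- The arrow underlying a matrix unit. -/
noncomputable def unitArrow (i : UnitIndex r) : G × G :=
  (i.2.1.2, (conjugator hr i.1 i.2.1.2)⁻¹ * (i.2.2 : G)⁻¹ * conjugator hr i.1 i.2.1.1)

theorem unitArrow_bijective : Function.Bijective (unitArrow hr) := by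
  constructor
  · rintro ⟨C, ⟨x, y⟩, s⟩ ⟨D, ⟨z, t⟩, s'⟩ h
    obtain rfl : C = D := by
      have h1 : (y : G) = t := congrArg Prod.fst h
      rw [← ConjClasses.mem_carrier_iff_mk_eq.1 y.2, ← ConjClasses.mem_carrier_iff_mk_eq.1 t.2, h1]
    obtain rfl : y = t := Subtype.ext (congrArg Prod.fst h)
    have h2 : (s : G)⁻¹ * conjugator hr C x = (s' : G)⁻¹ * conjugator hr C z := by
      have h3 := congrArg Prod.snd h
      simp only [unitArrow, mul_assoc] at h3
      exact mul_left_cancel h3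
    obtain rfl : x = z := by
      apply Subtype.ext
      have h4 : ∀ (w : C.carrier) (k : Cent r C), ((k : G)⁻¹ * conjugator hr C w)⁻¹ * r C *
          ((k : G)⁻¹ * conjugator hr C w) = w := fun w k => by
        rw [← conjugator_spec hr C w]
        conv_rhs => rw [← cent_conj C k]
        group
      rw [← h4 x s, h2, h4]
    obtain rfl : s = s' := Subtype.ext (inv_injective (mul_right_cancel h2))
    rfl
  · rintro ⟨y, g⟩
    let C := ConjClasses.mk y
    let y' : C.carrier := ⟨y, ConjClasses.mem_carrier_mk⟩
    let x' : C.carrier := ⟨g⁻¹ * y * g, ConjClasses.mem_carrier_iff_mk_eq.2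
      (ConjClasses.mk_eq_mk_iff_isConj.2 (isConj_iff.2 ⟨g, by group⟩))⟩
    have hs : (conjugator hr C y' * g * (conjugator hr C x')⁻¹)⁻¹ ∈
        Subgroup.centralizer ({r C} : Set G) := by
      refine inv_mem (Subgroup.mem_centralizer_iff.2 ?_)
      rintro _ rfl
      have h1 := conjugator_spec' hr C y'
      have h2 := conjugator_spec' hr C x'
      change _ * (g⁻¹ * y * g) * _ = _ at h2
      change _ * y * _ = _ at h1
      conv_lhs => rw [← h1]
      conv_rhs => rw [← h2]
      group
    refine ⟨⟨C, ⟨x', y'⟩, ⟨_, hs⟩⟩, Prod.ext rfl ?_⟩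
    change (conjugator hr C y')⁻¹ * ((conjugator hr C y' * g * (conjugator hr C x')⁻¹)⁻¹)⁻¹ *
      conjugator hr C x' = g
    group

/-- The basis of matrix units of the tube algebra. -/
noncomputable def tubeUnitBasis : Module.Basis (UnitIndex r) ℂ K.Tube :=
  (K.tubeBasis.reindex (Equiv.ofBijective _ (unitArrow_bijective hr)).symm).unitsSMul fun i =>
    Circle.toUnits (K.exists_tubeUnit_eq hr i.1 i.2.1.1 i.2.1.2 i.2.2).choose

theorem tubeUnitBasis_apply (i : UnitIndex r) :
    K.tubeUnitBasis hr i = K.tubeUnit hr i.1 i.2.1.1 i.2.1.2 i.2.2 := by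
  rw [(K.exists_tubeUnit_eq hr i.1 i.2.1.1 i.2.1.2 i.2.2).choose_spec, tubeUnitBasis,
    Module.Basis.unitsSMul_apply, Module.Basis.reindex_apply, tubeBasis_apply]
  rfl

theorem tubeUnit_mul_tubeUnit_cases {p : ∀ (C : ConjClasses G) (_ _ : C.carrier) (_ : Cent r C)
    (D : ConjClasses G) (_ _ : D.carrier) (_ : Cent r D), Prop}
    (eq : ∀ C x y z s t, p C x y s C y z t)
    (ne : ∀ C x (y : C.carrier) s D (z : D.carrier) t s', (y : G) ≠ z → p C x y s D z t s')
    (C : ConjClasses G) (x y : C.carrier) (s : Cent r C)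
    (D : ConjClasses G) (z t : D.carrier) (s' : Cent r D) : p C x y s D z t s' := by
  by_cases h : (y : G) = z
  · obtain rfl : C = D := by
      rw [← ConjClasses.mem_carrier_iff_mk_eq.1 y.2, ← ConjClasses.mem_carrier_iff_mk_eq.1 z.2, h]
    obtain rfl : y = z := Subtype.ext h
    exact eq _ _ _ _ _ _
  · exact ne _ _ _ _ _ _ _ _ h

theorem nonempty_starAlgEquiv (hr : ∀ C, ConjClasses.mk (r C) = C) :
    Nonempty (K.Tube ≃⋆ₐ[ℂ] K.ClassAlgebra r) := by
  set f := (K.tubeUnitBasis hr).equiv (K.classBasis r) (Equiv.refl _)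
  have hf : ∀ C x y s, f (K.tubeUnit hr C x y s) = K.classUnit r C x y s := fun C x y s => by
    have h := K.tubeUnitBasis_apply hr ⟨C, ⟨x, y⟩, s⟩
    rw [← h, Module.Basis.equiv_apply, classBasis_apply]
    rfl
  have hmul : ∀ x y, f (x * y) = f x * f y := by
    refine map_mul_of_basis (K.tubeUnitBasis hr) f.toLinearMap ?_
    rintro ⟨C, ⟨x, y⟩, s⟩ ⟨D, ⟨z, t⟩, s'⟩
    simp only [tubeUnitBasis_apply, LinearEquiv.coe_coe, hf]
    induction C, x, y, s, D, z, t, s' using tubeUnit_mul_tubeUnit_cases with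
    | eq => rw [tubeUnit_mul, classUnit_mul, map_smul, hf]
    | ne C x y s D z t s' h =>
      rw [K.tubeUnit_mul_of_ne hr h, K.classUnit_mul_of_ne r h, map_zero]
  have hstar : ∀ x, f (star x) = star (f x) := by
    refine map_star_of_basis K.tube_star_add (AlgSum.star_add' _) (K.tubeUnitBasis hr)
      f.toLinearMap ?_
    rintro ⟨C, ⟨x, y⟩, s⟩
    simp only [tubeUnitBasis_apply, LinearEquiv.coe_coe, hf]
    rw [star_tubeUnit, star_classUnit, map_smul, hf]
  exact ⟨{ f with
    map_mul' := hmul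
    map_star' := hstar
    map_smul' := fun c x => map_smul f c x }⟩

end GKernel

namespace HilbRep

variable {A : Type*} [NonUnitalNonAssocRing A] [Module ℂ A] [Star A] (X : HilbRep.{w} A)

theorem π_mul (x y : A) (ξ : X.V) : X.π (x * y) ξ = X.π x (X.π y ξ) := by
  rw [map_mul]
  rfl

/-- A subspace containing the images of a vector under a basis contains its whole orbit. -/
theorem π_mem_of_basis {ι : Type*} (a : Module.Basis ι ℂ A) {W : Submodule ℂ X.V} {ξ : X.V}
    (h : ∀ i, X.π (a i) ξ ∈ W) (x : A) : X.π x ξ ∈ W := by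
  induction x using basis_smul_induction a with
  | zero => rw [map_zero]; exact zero_mem _
  | add x y hx hy => rw [map_add]; exact add_mem hx hy
  | basis i c => rw [map_smul]; exact Submodule.smul_mem _ c (h i)

theorem inner_π (x : A) (ξ η : X.V) : ⟪ξ, X.π x η⟫_ℂ = ⟪X.π (star x) ξ, η⟫_ℂ := by
  rw [map_star, ContinuousLinearMap.star_eq_adjoint, ContinuousLinearMap.adjoint_inner_left]

theorem isSubmodule_generated (S : Set X.V) : X.IsSubmodule (X.generated S) := by
  refine ⟨?_, fun x ξ hξ => ?_⟩
  · rw [generated, Submodule.coe_sInf]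
    exact isClosed_biInter fun W hW => hW.1.1
  · rw [generated, Submodule.mem_sInf] at hξ ⊢
    exact fun W hW => hW.1.2 x ξ (hξ W hW)

theorem subset_generated (S : Set X.V) : S ⊆ X.generated S := fun ξ hξ => by
  rw [SetLike.mem_coe, generated, Submodule.mem_sInf]
  exact fun W hW => hW.2 hξ

theorem generated_le {S : Set X.V} {W : Submodule ℂ X.V} (hW : X.IsSubmodule W) (h : S ⊆ W) :
    X.generated S ≤ W := sInf_le ⟨hW, h⟩

variable {X}

theorem IsSubmodule.orthogonal {W : Submodule ℂ X.V} (hW : ∀ x, ∀ ξ ∈ W, X.π x ξ ∈ W) :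
    X.IsSubmodule Wᗮ := by
  refine ⟨Submodule.isClosed_orthogonal _, fun x ξ hξ η hη => ?_⟩
  rw [inner_π]
  exact hξ _ (hW _ _ hη)

theorem IsSubmodule.topologicalClosure {W : Submodule ℂ X.V} (hW : ∀ x, ∀ ξ ∈ W, X.π x ξ ∈ W) :
    X.IsSubmodule W.topologicalClosure :=
  ⟨W.isClosed_topologicalClosure, fun x _ hξ =>
    map_mem_closure (X.π x).continuous hξ fun _ hη => hW x _ hη⟩

theorem isSubmodule_eqLocus {Y : HilbRep.{w} A} (S T : X.V →L[ℂ] Y.V)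
    (hS : ∀ x ξ, S (X.π x ξ) = Y.π x (S ξ)) (hT : ∀ x ξ, T (X.π x ξ) = Y.π x (T ξ)) :
    X.IsSubmodule (LinearMap.eqLocus (S : X.V →ₗ[ℂ] Y.V) T) := by
  refine ⟨isClosed_eq S.continuous T.continuous, fun x ξ hξ => ?_⟩
  change S (X.π x ξ) = T (X.π x ξ)
  rw [hS, hT]
  exact congrArg _ hξ

end HilbRep

namespace GKernel

open HilbRep

variable {H : Type*} [NormedAddCommGroup H] [InnerProductSpace ℂ H] [CompleteSpace H]
  {M : II1Factor H} {G : Type*} [Group G] (K : GKernel M G)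

theorem arrow_mul_arrow_one (g s : G) : K.arrow g s * K.arrow g 1 = K.arrow g s := by
  rw [K.arrow_mul_arrow' (by group), mulCoeff_one_left, Circle.coe_one, one_smul, one_mul]

theorem arrow_one_mul_arrow (g s : G) : K.arrow (s⁻¹ * g * s) 1 * K.arrow g s = K.arrow g s := by
  rw [arrow_mul_arrow, mulCoeff_one_right, Circle.coe_one, one_smul, mul_one]

theorem star_arrow_one (g : G) : star (K.arrow g 1) = K.arrow g 1 := by
  rw [star_arrow, mulCoeff_one_left, inv_one, Circle.coe_one, one_smul, inv_one, one_mul, mul_one]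

variable {K} (X : HilbRep.{w} K.Tube)

theorem weightSpace_eq (g : G) : K.weightSpace X g = Set.range (X.π (K.arrow g 1)) := by
  rw [weightSpace, tubeProj_eq_arrow]

theorem π_mem_of_arrow {W : Submodule ℂ X.V} {ξ : X.V}
    (h : ∀ g s, X.π (K.arrow g s) ξ ∈ W) (x : K.Tube) : X.π x ξ ∈ W :=
  X.π_mem_of_basis K.tubeBasis (fun i => by rw [tubeBasis_apply]; exact h _ _) x

/-- The vectors whose components in the `g`-th spaces vanish for `g` outside a class. -/
noncomputable def awaySubmodule (C : ConjClasses G) : Submodule ℂ X.V :=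
  ⨅ g : {g : G // ConjClasses.mk g ≠ C}, LinearMap.ker (X.π (K.arrow g 1) : X.V →ₗ[ℂ] X.V)

theorem mem_awaySubmodule {C : ConjClasses G} {ξ : X.V} : ξ ∈ awaySubmodule X C ↔
    ∀ g, ConjClasses.mk g ≠ C → X.π (K.arrow g 1) ξ = 0 := by
  simp [awaySubmodule]

theorem isSubmodule_awaySubmodule (C : ConjClasses G) : X.IsSubmodule (awaySubmodule X C) := by
  refine ⟨?_, fun x ξ hξ => ?_⟩
  · rw [awaySubmodule, Submodule.coe_iInf]
    exact isClosed_iInter fun g => (X.π (K.arrow g 1)).isClosed_ker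
  · refine π_mem_of_arrow X (fun h s => ?_) x
    · rw [mem_awaySubmodule] at hξ ⊢
      intro g hg
      rw [← π_mul]
      by_cases hs : s⁻¹ * h * s = g
      · subst hs
        rw [arrow_one_mul_arrow, ← arrow_mul_arrow_one, π_mul, hξ, map_zero]
        rwa [ne_eq, ConjClasses.mk_eq_mk_iff_isConj.2 (isConj_iff.2 ⟨s⁻¹, by rw [inv_inv]⟩)]
      · rw [K.arrow_mul_arrow_of_ne hs, map_zero]
        rfl

variable {r : ConjClasses G → G}

theorem generated_weightSpace_le_awaySubmodule (hr : ∀ C, ConjClasses.mk (r C) = C)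
    (C : ConjClasses G) : X.generated (K.weightSpace X (r C)) ≤ awaySubmodule X C := by
  refine X.generated_le (isSubmodule_awaySubmodule X C) ?_
  rw [weightSpace_eq]
  rintro _ ⟨ξ, rfl⟩
  rw [SetLike.mem_coe, mem_awaySubmodule]
  intro g hg
  rw [← π_mul, K.arrow_mul_arrow_of_ne, map_zero]
  · rfl
  · rintro rfl
    apply hg
    rw [inv_one, one_mul, mul_one, hr]

theorem isClassDecomposition_generated (hr : ∀ C, ConjClasses.mk (r C) = C) :
    K.IsClassDecomposition r X (fun C => X.generated (K.weightSpace X (r C))) where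
  isSubmodule C := X.isSubmodule_generated _
  supported C := by rw [Set.inter_eq_right.2 (X.subset_generated _)]
  orthogonal C D hCD := by
    refine (Submodule.isOrtho_iff_le.2 ?_).symm
    refine X.generated_le (IsSubmodule.orthogonal (X.isSubmodule_generated _).2) ?_
    rw [weightSpace_eq]
    rintro _ ⟨ξ, rfl⟩ η hη
    rw [inner_π, star_arrow_one,
      (mem_awaySubmodule X).1 (generated_weightSpace_le_awaySubmodule X hr C hη), inner_zero_left]
    rw [hr]
    exact hCD.symm
  total := by
    rw [eq_top_iff, ← X.nondegenerate]
    refine Submodule.topologicalClosure_mono (Submodule.span_le.2 ?_)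
    rintro _ ⟨x, ξ, rfl⟩
    rw [SetLike.mem_coe]
    refine π_mem_of_arrow X (fun h s => ?_) x
    · set C := ConjClasses.mk h
      set x : C.carrier := ⟨h, ConjClasses.mem_carrier_mk⟩
      refine Submodule.mem_iSup_of_mem C ?_
      rw [← arrow_mul_arrow_one, ← K.tubeIso_mul_star_tubeIso hr C x, ← mul_assoc, π_mul]
      refine (X.isSubmodule_generated _).2 _ _ (X.subset_generated _ ?_)
      rw [weightSpace_eq]
      refine ⟨X.π (star (K.tubeIso hr C x)) ξ, ?_⟩
      rw [← π_mul]
      congr 2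
      rw [← K.star_tubeIso_mul_tubeIso hr C x, mul_assoc, tubeIso_mul_star_tubeIso,
        star_tubeIso, smul_mul_assoc, arrow_mul_arrow_one]

theorem IsClassDecomposition.eq_generated {W : ConjClasses G → Submodule ℂ X.V}
    (hr : ∀ C, ConjClasses.mk (r C) = C) (hW : K.IsClassDecomposition r X W)
    (C : ConjClasses G) : W C = X.generated (K.weightSpace X (r C)) := by
  have hle : ∀ C, W C ≤ X.generated (K.weightSpace X (r C)) := fun C => by
    rw [← hW.supported C]
    exact X.generated_le (X.isSubmodule_generated _)
      (Set.inter_subset_right.trans (X.subset_generated _))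
  refine le_antisymm (hle C) fun ξ hξ => ?_
  have : CompleteSpace (W C) := (hW.isSubmodule C).1.completeSpace_coe
  obtain ⟨η, hη, ζ, hζ, rfl⟩ := (W C).exists_add_mem_mem_orthogonal ξ
  have hζ' : ζ ∈ X.generated (K.weightSpace X (r C)) := by
    have := sub_mem hξ (hle C hη)
    rwa [add_sub_cancel_left] at this
  have hζ0 : ζ ∈ (⨆ D, W D)ᗮ := by
    rw [← Submodule.iInf_orthogonal, Submodule.mem_iInf]
    intro D
    by_cases hD : D = C
    · rwa [hD]
    · exact fun v hv => ((isClassDecomposition_generated X hr).orthogonal D C hD).inner_eq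
        (hle D hv) hζ'
  rw [← Submodule.orthogonal_closure, hW.total, Submodule.top_orthogonal_eq_bot,
    Submodule.mem_bot] at hζ0
  rw [hζ0, add_zero]
  exact hη

end GKernel

namespace TwistedGroupAlgebra

variable {L : Type*} [Group L] (φ : TwoCocycle L)

/-- The basis of group elements. -/
noncomputable def groupBasis : Module.Basis L ℂ (TwistedGroupAlgebra φ) :=
  .ofRepr (LinearEquiv.refl ℂ (L →₀ ℂ))

theorem groupBasis_apply (s : L) : groupBasis φ s = basisElt φ s := rfl

theorem one_mul' (a : TwistedGroupAlgebra φ) : basisElt φ 1 * a = a := by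
  induction a using basis_smul_induction (groupBasis φ) with
  | zero => rw [mul_zero]
  | add x y hx hy => rw [mul_add, hx, hy]
  | basis s c =>
    rw [mul_smul_comm, groupBasis_apply, basisElt_mul_basisElt, φ.one_left, one_mul,
      Circle.coe_one, one_smul]

variable {φ}

theorem π_one_apply (W : HilbRep.{w} (TwistedGroupAlgebra φ)) (ξ : W.V) :
    W.π (basisElt φ 1) ξ = ξ := by
  have h : (Submodule.span ℂ {v : W.V | ∃ x ξ, W.π x ξ = v}).topologicalClosure ≤
      LinearMap.eqLocus (W.π (basisElt φ 1) : W.V →ₗ[ℂ] W.V) LinearMap.id := by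
    refine Submodule.topologicalClosure_minimal _ (Submodule.span_le.2 ?_)
      (isClosed_eq (W.π (basisElt φ 1)).continuous continuous_id)
    rintro _ ⟨x, η, rfl⟩
    change W.π (basisElt φ 1) (W.π x η) = W.π x η
    rw [← W.π_mul, one_mul']
  rw [W.nondegenerate] at h
  exact h (Submodule.mem_top (x := ξ))

end TwistedGroupAlgebra

namespace GKernel

open HilbRep TwistedGroupAlgebra

variable {H : Type*} [NormedAddCommGroup H] [InnerProductSpace ℂ H] [CompleteSpace H]
  {M : II1Factor H} {G : Type*} [Group G] (K : GKernel M G) (r : ConjClasses G → G)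
  (C : ConjClasses G)

/-- The twisted group algebra as a corner of the tube algebra. -/
noncomputable def cornerMap : TwistedGroupAlgebra (K.phiC (r C)) →ₗ[ℂ] K.Tube :=
  (groupBasis (K.phiC (r C))).constr ℂ (K.cornerElt r C)

theorem cornerMap_basisElt (s : Cent r C) :
    K.cornerMap r C (basisElt (K.phiC (r C)) s) = K.cornerElt r C s := by
  rw [← groupBasis_apply, cornerMap, Module.Basis.constr_basis]

theorem cornerMap_mul (a b : TwistedGroupAlgebra (K.phiC (r C))) :
    K.cornerMap r C (a * b) = K.cornerMap r C a * K.cornerMap r C b :=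
  map_mul_of_basis (groupBasis _) (K.cornerMap r C) (fun s t => by
    rw [groupBasis_apply, groupBasis_apply, basisElt_mul_basisElt, map_smul, cornerMap_basisElt,
      cornerMap_basisElt, cornerMap_basisElt, cornerElt_mul]) a b

theorem cornerMap_star (a : TwistedGroupAlgebra (K.phiC (r C))) :
    K.cornerMap r C (star a) = star (K.cornerMap r C a) :=
  map_star_of_basis star_add K.tube_star_add (groupBasis _) (K.cornerMap r C) (fun s => by
    rw [groupBasis_apply, star_basisElt, map_smul, cornerMap_basisElt, cornerMap_basisElt,
      star_cornerElt]) a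

theorem cornerMap_one : K.cornerMap r C (basisElt _ 1) = K.arrow (r C) 1 := by
  rw [cornerMap_basisElt, cornerElt_one]

theorem arrow_one_mul_cornerMap (a : TwistedGroupAlgebra (K.phiC (r C))) :
    K.arrow (r C) 1 * K.cornerMap r C a = K.cornerMap r C a := by
  rw [← cornerMap_one, ← cornerMap_mul, one_mul']

variable {K} (X : HilbRep.{w} K.Tube)

/-- The space of the representative of a class, as a subspace. -/
noncomputable def cornerSpace : Submodule ℂ X.V :=
  LinearMap.eqLocus (X.π (K.arrow (r C) 1) : X.V →ₗ[ℂ] X.V) LinearMap.id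

variable {r C X} in
theorem mem_cornerSpace {ξ : X.V} : ξ ∈ cornerSpace r C X ↔ X.π (K.arrow (r C) 1) ξ = ξ := Iff.rfl

theorem coe_cornerSpace : (cornerSpace r C X : Set X.V) = K.weightSpace X (r C) := by
  rw [weightSpace_eq]
  ext ξ
  constructor
  · exact fun h => ⟨ξ, h⟩
  · rintro ⟨η, rfl⟩
    rw [SetLike.mem_coe, mem_cornerSpace, ← π_mul, arrow_mul_arrow_one]

instance : CompleteSpace (cornerSpace r C X) :=
  (isClosed_eq (X.π (K.arrow (r C) 1)).continuous continuous_id).completeSpace_coe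

theorem cornerMap_mem (a : TwistedGroupAlgebra (K.phiC (r C))) (ξ : X.V) :
    X.π (K.cornerMap r C a) ξ ∈ cornerSpace r C X := by
  rw [mem_cornerSpace, ← π_mul, arrow_one_mul_cornerMap]

/-- The representation of the twisted group algebra on the space of the representative. -/
noncomputable def cornerRep : HilbRep.{w} (TwistedGroupAlgebra (K.phiC (r C))) where
  V := cornerSpace r C X
  π :=
    { toFun := fun a => ((X.π (K.cornerMap r C a)).comp (cornerSpace r C X).subtypeL).codRestrict
        (cornerSpace r C X) fun ξ => cornerMap_mem r C X a ξ
      map_smul' := fun c a => by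
        ext ξ
        change X.π (K.cornerMap r C (c • a)) ξ = c • X.π (K.cornerMap r C a) ξ
        rw [map_smul, map_smul]
        rfl
      map_zero' := by
        ext ξ
        change X.π (K.cornerMap r C 0) ξ = 0
        rw [map_zero, map_zero]
        rfl
      map_add' := fun a b => by
        ext ξ
        change X.π (K.cornerMap r C (a + b)) ξ =
          X.π (K.cornerMap r C a) ξ + X.π (K.cornerMap r C b) ξ
        rw [map_add, map_add]
        rfl
      map_mul' := fun a b => by
        ext ξ
        change X.π (K.cornerMap r C (a * b)) ξ =
          X.π (K.cornerMap r C a) (X.π (K.cornerMap r C b) ξ)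
        rw [cornerMap_mul, π_mul]
      map_star' := fun a => by
        rw [ContinuousLinearMap.star_eq_adjoint, ContinuousLinearMap.eq_adjoint_iff]
        intro ξ η
        change ⟪X.π (K.cornerMap r C (star a)) ξ, (η : X.V)⟫_ℂ =
          ⟪(ξ : X.V), X.π (K.cornerMap r C a) η⟫_ℂ
        rw [cornerMap_star, inner_π] }
  nondegenerate := by
    rw [eq_top_iff]
    refine le_trans ?_ (Submodule.le_topologicalClosure _)
    refine fun ξ _ => Submodule.subset_span ⟨basisElt _ 1, ξ, Subtype.ext ?_⟩
    change X.π (K.cornerMap r C (basisElt _ 1)) ξ = ξ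
    rw [cornerMap_one]
    exact ξ.2

/-- The inclusion of the space of the representative. -/
noncomputable def cornerIncl : (cornerRep r C X).V →ₗᵢ[ℂ] X.V := (cornerSpace r C X).subtypeₗᵢ

theorem cornerIncl_π (a : TwistedGroupAlgebra (K.phiC (r C))) (ξ : (cornerRep r C X).V) :
    cornerIncl r C X ((cornerRep r C X).π a ξ) = X.π (K.cornerMap r C a) (cornerIncl r C X ξ) := rfl

theorem π_cornerIncl (ξ : (cornerRep r C X).V) :
    X.π (K.arrow (r C) 1) (cornerIncl r C X ξ) = cornerIncl r C X ξ := Subtype.prop ξ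

variable {X} {Y : HilbRep.{w} K.Tube}

/-- The restriction of an intertwiner to the spaces of the representative. -/
noncomputable def cornerHom (f : X ⟶ Y) : cornerRep r C X ⟶ cornerRep r C Y :=
  ⟨(f.toMap.comp (cornerSpace r C X).subtypeL).codRestrict (cornerSpace r C Y) fun ξ => by
      change Y.π _ (f.toMap ξ) = f.toMap ξ
      rw [← f.comm]
      exact congrArg f.toMap ξ.2,
    fun a ξ => Subtype.ext (f.comm _ _)⟩

/-- Passing to the space of the representative of a class. -/
noncomputable def cornerFunctor : (K.supportedOn (r C)).FullSubcategory ⥤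
    HilbRep.{w} (TwistedGroupAlgebra (K.phiC (r C))) where
  obj X := cornerRep r C X.obj
  map f := cornerHom r C f.hom

instance : (cornerFunctor (K := K) r C).Additive where

instance : (cornerFunctor (K := K) r C).Linear ℂ where

instance : (cornerFunctor.{w} (K := K) r C).Faithful where
  map_injective {X Y f g} h := by
    refine InducedCategory.Hom.ext (HilbRep.Hom.ext (ContinuousLinearMap.ext fun ξ => ?_))
    have hle : X.obj.generated (K.weightSpace X.obj (r C)) ≤
        LinearMap.eqLocus (f.hom.toMap : X.obj.V →ₗ[ℂ] Y.obj.V) g.hom.toMap := by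
      refine X.obj.generated_le (isSubmodule_eqLocus _ _ f.hom.comm g.hom.comm) ?_
      rw [← coe_cornerSpace]
      intro η hη
      exact congrArg (fun k : cornerRep r C X.obj ⟶ cornerRep r C Y.obj =>
        cornerIncl r C Y.obj (k.toMap ⟨η, hη⟩)) h
    have hX : X.obj.generated (K.weightSpace X.obj (r C)) = ⊤ := X.property
    rw [hX] at hle
    exact hle (Submodule.mem_top (x := ξ))

end GKernel

namespace GKernel

open HilbRep TwistedGroupAlgebra

variable {H : Type*} [NormedAddCommGroup H] [InnerProductSpace ℂ H] [CompleteSpace H]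
  {M : II1Factor H} {G : Type*} [Group G] (K : GKernel M G) {r : ConjClasses G → G}
  (hr : ∀ C, ConjClasses.mk (r C) = C) (C : ConjClasses G)

theorem tubeUnit_mul_tubeIso (x y : C.carrier) (s : Cent r C) :
    K.tubeUnit hr C x y s * K.tubeIso hr C y = K.tubeIso hr C x * K.cornerElt r C s := by
  rw [tubeUnit, mul_assoc, star_tubeIso_mul_tubeIso, ← cornerElt_one, mul_assoc, cornerElt_mul,
    (K.phiC (r C)).one_right, mul_one, Circle.coe_one, one_smul]

theorem tubeUnit_mul_tubeIso_of_ne {D : ConjClasses G} (x y : D.carrier) (s : Cent r D)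
    (z : C.carrier) (h : (y : G) ≠ z) : K.tubeUnit hr D x y s * K.tubeIso hr C z = 0 := by
  rw [tubeUnit, mul_assoc, K.star_tubeIso_mul_tubeIso_of_ne hr h, mul_zero]

variable {K} (X : HilbRep.{w} K.Tube)

/-- The isometry from the space of the representative of a class to the `x`-th space. -/
noncomputable def transport (x : C.carrier) : (cornerRep r C X).V →ₗᵢ[ℂ] X.V :=
  LinearMap.isometryOfInner
    ((X.π (K.tubeIso hr C x) : X.V →ₗ[ℂ] X.V) ∘ₗ (cornerIncl r C X).toLinearMap) fun ξ η => by
      change ⟪X.π _ (cornerIncl r C X ξ), X.π _ (cornerIncl r C X η)⟫_ℂ = _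
      rw [inner_π, ← π_mul, star_tubeIso_mul_tubeIso, π_cornerIncl, LinearIsometry.inner_map_map]

theorem transport_apply (x : C.carrier) (ξ : (cornerRep r C X).V) :
    transport hr C X x ξ = X.π (K.tubeIso hr C x) (cornerIncl r C X ξ) := rfl

theorem transport_of_eq (x : C.carrier) (hx : (x : G) = r C) (ξ : (cornerRep r C X).V) :
    transport hr C X x ξ = cornerIncl r C X ξ := by
  rw [transport_apply, K.tubeIso_of_eq hr C x hx, π_cornerIncl]

theorem π_tubeUnit_transport (x y : C.carrier) (s : Cent r C) (ξ : (cornerRep r C X).V) :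
    X.π (K.tubeUnit hr C x y s) (transport hr C X y ξ) =
      transport hr C X x ((cornerRep r C X).π (basisElt _ s) ξ) := by
  rw [transport_apply, transport_apply, cornerIncl_π, cornerMap_basisElt, ← π_mul, ← π_mul,
    tubeUnit_mul_tubeIso]

theorem π_tubeUnit_transport_of_ne {D : ConjClasses G} (x y : D.carrier) (s : Cent r D)
    (z : C.carrier) (h : (y : G) ≠ z) (ξ : (cornerRep r C X).V) :
    X.π (K.tubeUnit hr D x y s) (transport hr C X z ξ) = 0 := by
  rw [transport_apply, ← π_mul, K.tubeUnit_mul_tubeIso_of_ne hr C x y s z h, map_zero]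
  rfl

theorem orthogonalFamily_transport :
    OrthogonalFamily ℂ (fun _ : C.carrier => (cornerRep r C X).V) (transport hr C X) := by
  intro x y hxy ξ η
  rw [transport_apply, transport_apply, inner_π, ← π_mul,
    K.star_tubeIso_mul_tubeIso_of_ne hr (fun h => hxy.symm (Subtype.ext h)), map_zero]
  exact inner_zero_left _

theorem iSup_range_transport_invariant (a : K.Tube) (ξ : X.V)
    (hξ : ξ ∈ ⨆ x, LinearMap.range (transport hr C X x).toLinearMap) :
    X.π a ξ ∈ ⨆ x, LinearMap.range (transport hr C X x).toLinearMap := by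
  induction hξ using Submodule.iSup_induction' with
  | zero => rw [map_zero]; exact zero_mem _
  | add η ζ _ _ h h' => rw [map_add]; exact add_mem h h'
  | mem z η hη =>
    obtain ⟨η, rfl⟩ := hη
    refine X.π_mem_of_basis (K.tubeUnitBasis hr) ?_ a
    rintro ⟨D, ⟨x, y⟩, s⟩
    rw [tubeUnitBasis_apply]
    change X.π (K.tubeUnit hr D x y s) (transport hr C X z η) ∈ _
    by_cases h : (y : G) = z
    · obtain rfl : D = C := by
        rw [← ConjClasses.mem_carrier_iff_mk_eq.1 y.2, ← ConjClasses.mem_carrier_iff_mk_eq.1 z.2, h]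
      obtain rfl : y = z := Subtype.ext h
      rw [π_tubeUnit_transport]
      exact Submodule.mem_iSup_of_mem x ⟨_, rfl⟩
    · rw [π_tubeUnit_transport_of_ne hr C X x y s z h]
      exact zero_mem _

/-- The representative of a class, as an element of it. -/
def basePoint : C.carrier := ⟨r C, ConjClasses.mem_carrier_iff_mk_eq.2 (hr C)⟩

theorem closure_iSup_range_transport (hX : K.supportedOn (r C) X) :
    (⨆ x, LinearMap.range (transport hr C X x).toLinearMap).topologicalClosure = ⊤ := by
  have hX' : X.generated (K.weightSpace X (r C)) = ⊤ := hX
  rw [eq_top_iff, ← hX']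
  refine X.generated_le (IsSubmodule.topologicalClosure
    (iSup_range_transport_invariant hr C X)) ?_
  refine Set.Subset.trans ?_ (Submodule.le_topologicalClosure _)
  rw [← coe_cornerSpace]
  intro ξ hξ
  refine Submodule.mem_iSup_of_mem (basePoint hr C) ⟨⟨ξ, hξ⟩, ?_⟩
  exact transport_of_eq hr C X _ rfl _

theorem isHilbertSum_transport (hX : K.supportedOn (r C) X) :
    IsHilbertSum ℂ (fun _ : C.carrier => (cornerRep r C X).V) (transport hr C X) :=
  IsHilbertSum.mk (orthogonalFamily_transport hr C X) (closure_iSup_range_transport hr C X hX).ge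

variable {X} {Y : HilbRep.{w} K.Tube}

/-- An intertwiner between the spaces of the representative extends to the whole spaces. -/
theorem exists_extension (hX : K.supportedOn (r C) X) (hY : K.supportedOn (r C) Y)
    (g : cornerRep r C X ⟶ cornerRep r C Y) :
    ∃ T : X.V →L[ℂ] Y.V, ∀ x ξ, T (transport hr C X x ξ) = transport hr C Y x (g.toMap ξ) := by
  classical
  have hX' := isHilbertSum_transport hr C X hX
  have hY' := isHilbertSum_transport hr C Y hY
  let S : lp (fun _ : C.carrier => (cornerRep r C X).V) 2 →L[ℂ]
      lp (fun _ : C.carrier => (cornerRep r C Y).V) 2 :=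
    lp.mapCLM 2 (fun _ => g.toMap) (norm_nonneg g.toMap) fun _ => le_rfl
  refine ⟨(hY'.linearIsometryEquiv.symm.toContinuousLinearEquiv :
    lp (fun _ : C.carrier => (cornerRep r C Y).V) 2 →L[ℂ] Y.V) ∘L S ∘L
      (hX'.linearIsometryEquiv.toContinuousLinearEquiv :
        X.V →L[ℂ] lp (fun _ : C.carrier => (cornerRep r C X).V) 2), fun x ξ => ?_⟩
  change hY'.linearIsometryEquiv.symm (S (hX'.linearIsometryEquiv (transport hr C X x ξ))) = _
  have h1 : hX'.linearIsometryEquiv (transport hr C X x ξ) = lp.single 2 x ξ := by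
    rw [← hX'.linearIsometryEquiv_symm_apply_single, LinearIsometryEquiv.apply_symm_apply]
  have h2 : S (lp.single 2 x ξ) = lp.single 2 x (g.toMap ξ) := by
    ext y
    change g.toMap ((lp.single 2 x ξ : lp (fun _ : C.carrier => (cornerRep r C X).V) 2) y) = _
    by_cases h : y = x
    · subst h
      rw [lp.single_apply_self, lp.single_apply_self]
    · rw [lp.single_apply_ne _ _ _ h, lp.single_apply_ne _ _ _ h, map_zero]
  rw [h1, h2, hY'.linearIsometryEquiv_symm_apply_single]

theorem intertwines_of_transport (hX : K.supportedOn (r C) X)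
    (g : cornerRep r C X ⟶ cornerRep r C Y) (T : X.V →L[ℂ] Y.V)
    (hT : ∀ x ξ, T (transport hr C X x ξ) = transport hr C Y x (g.toMap ξ)) (a : K.Tube)
    (ξ : X.V) : T (X.π a ξ) = Y.π a (T ξ) := by
  have hle : (⨆ x, LinearMap.range (transport hr C X x).toLinearMap).topologicalClosure ≤
      LinearMap.eqLocus (T ∘L X.π a : X.V →ₗ[ℂ] Y.V) (Y.π a ∘L T : X.V →L[ℂ] Y.V) := by
    refine Submodule.topologicalClosure_minimal _ (iSup_le fun z => ?_)
      (isClosed_eq (T ∘L X.π a).continuous (Y.π a ∘L T).continuous)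
    rintro _ ⟨η, rfl⟩
    change T (X.π a (transport hr C X z η)) = Y.π a (T (transport hr C X z η))
    induction a using basis_smul_induction (K.tubeUnitBasis hr) with
    | zero =>
      rw [map_zero, map_zero]
      exact map_zero T
    | add a b ha hb =>
      rw [map_add, map_add, add_apply, add_apply, map_add, ha, hb]
    | basis i c =>
      obtain ⟨D, ⟨x, y⟩, s⟩ := i
      rw [map_smul, map_smul, smul_apply, smul_apply, map_smul]
      congr 1
      rw [tubeUnitBasis_apply, hT]
      change T (X.π (K.tubeUnit hr D x y s) _) = Y.π (K.tubeUnit hr D x y s) _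
      by_cases h : (y : G) = z
      · obtain rfl : D = C := by
          rw [← ConjClasses.mem_carrier_iff_mk_eq.1 y.2, ← ConjClasses.mem_carrier_iff_mk_eq.1 z.2,
            h]
        obtain rfl : y = z := Subtype.ext h
        rw [π_tubeUnit_transport, π_tubeUnit_transport, hT, g.comm]
      · rw [π_tubeUnit_transport_of_ne hr C X x y s z h,
          π_tubeUnit_transport_of_ne hr C Y x y s z h, map_zero]
  rw [closure_iSup_range_transport hr C X hX] at hle
  exact hle (Submodule.mem_top (x := ξ))

theorem exists_cornerHom_eq (hr : ∀ C, ConjClasses.mk (r C) = C) (hX : K.supportedOn (r C) X)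
    (hY : K.supportedOn (r C) Y) (g : cornerRep r C X ⟶ cornerRep r C Y) :
    ∃ f : X ⟶ Y, cornerHom r C f = g := by
  obtain ⟨T, hT⟩ := exists_extension hr C hX hY g
  refine ⟨⟨T, intertwines_of_transport hr C hX g T hT⟩, ?_⟩
  refine HilbRep.Hom.ext (ContinuousLinearMap.ext fun ξ => (cornerIncl r C Y).injective ?_)
  change T (cornerIncl r C X ξ) = cornerIncl r C Y (g.toMap ξ)
  rw [← transport_of_eq hr C X (basePoint hr C) rfl,
    ← transport_of_eq hr C Y (basePoint hr C) rfl, hT]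

theorem full_cornerFunctor (hr : ∀ C, ConjClasses.mk (r C) = C) (C : ConjClasses G) :
    (cornerFunctor.{w} (K := K) r C).Full where
  map_surjective {X Y} g := by
    obtain ⟨f, hf⟩ := exists_cornerHom_eq C hr X.property Y.property g
    exact ⟨ObjectProperty.homMk f, hf⟩

end GKernel

section HilbertSum

variable {ι : Type*} {E : Type*} [NormedAddCommGroup E] [InnerProductSpace ℂ E]

open Classical in
/-- The inclusion of a summand in a Hilbert sum of copies of `E`. -/
noncomputable def l2Incl (i : ι) : E →L[ℂ] lp (fun _ : ι => E) 2 :=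
  lp.singleContinuousLinearMap ℂ (fun _ : ι => E) 2 i

theorem eq_top_of_l2Incl_mem {W : Submodule ℂ (lp (fun _ : ι => E) 2)}
    (hW : IsClosed (W : Set (lp (fun _ : ι => E) 2))) (h : ∀ i ξ, l2Incl i ξ ∈ W) : W = ⊤ := by
  classical
  refine eq_top_iff.2 fun f _ => ?_
  exact hW.mem_of_tendsto (lp.hasSum_single ENNReal.ofNat_ne_top f)
    (Filter.Eventually.of_forall fun s => sum_mem fun i _ => h i (f i))

variable [CompleteSpace E]

theorem adjoint_l2Incl_comp_self (i : ι) :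
    (l2Incl i : E →L[ℂ] lp (fun _ : ι => E) 2).adjoint ∘L l2Incl i = 1 := by
  classical
  refine ContinuousLinearMap.ext fun ξ => ext_inner_left ℂ fun η => ?_
  rw [ContinuousLinearMap.comp_apply, ContinuousLinearMap.adjoint_inner_right]
  change ⟪(lp.single 2 i η : lp (fun _ : ι => E) 2), lp.single (E := fun _ : ι => E) 2 i ξ⟫_ℂ = _
  rw [lp.inner_single_left, lp.single_apply_self]
  rfl

theorem adjoint_l2Incl_comp_of_ne {i j : ι} (h : i ≠ j) :
    (l2Incl i : E →L[ℂ] lp (fun _ : ι => E) 2).adjoint ∘L l2Incl j = 0 := by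
  classical
  refine ContinuousLinearMap.ext fun ξ => ext_inner_left ℂ fun η => ?_
  rw [ContinuousLinearMap.comp_apply, ContinuousLinearMap.adjoint_inner_right]
  change ⟪(lp.single 2 i η : lp (fun _ : ι => E) 2), lp.single (E := fun _ : ι => E) 2 j ξ⟫_ℂ = _
  rw [lp.inner_single_left, lp.single_apply_ne _ _ _ h, inner_zero_right]
  exact (inner_zero_right _).symm

theorem adjoint_l2Incl_apply (i : ι) (ξ : E) :
    (l2Incl i : E →L[ℂ] lp (fun _ : ι => E) 2).adjoint (l2Incl i ξ) = ξ :=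
  congrArg (fun T : E →L[ℂ] E => T ξ) (adjoint_l2Incl_comp_self i)

end HilbertSum

namespace GKernel

open HilbRep TwistedGroupAlgebra

variable {H : Type v} [NormedAddCommGroup H] [InnerProductSpace ℂ H] [CompleteSpace H]
  {M : II1Factor H} {G : Type u} [Group G] {K : GKernel M G} {r : ConjClasses G → G}
  (hr : ∀ C, ConjClasses.mk (r C) = C) (C : ConjClasses G)
  (W : HilbRep.{max u w} (TwistedGroupAlgebra (K.phiC (r C))))

/-- The Hilbert space of the representation induced from the corner of a class. -/
abbrev InducedSpace : Type _ := lp (fun _ : C.carrier => W.V) 2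

/-- The action of `E_{xy} ⊗ [s]` on `ℓ²(C) ⊗ W`. -/
noncomputable def inducedUnit (x y : C.carrier) (s : Cent r C) :
    InducedSpace C W →L[ℂ] InducedSpace C W :=
  l2Incl x ∘L W.π (basisElt _ s) ∘L (l2Incl y).adjoint

theorem inducedUnit_mul (x y z : C.carrier) (s t : Cent r C) :
    inducedUnit C W x y s * inducedUnit C W y z t =
      ((K.phiC (r C)).toFun s t : ℂ) • inducedUnit C W x z (s * t) := by
  refine ContinuousLinearMap.ext fun f => ?_
  change l2Incl x (W.π _ ((l2Incl y).adjoint (l2Incl y (W.π _ ((l2Incl z).adjoint f))))) =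
    ((K.phiC (r C)).toFun s t : ℂ) • l2Incl x (W.π _ ((l2Incl z).adjoint f))
  rw [adjoint_l2Incl_apply, ← π_mul, basisElt_mul_basisElt, map_smul, smul_apply, map_smul]

theorem inducedUnit_mul_of_ne (x y z t : C.carrier) (s s' : Cent r C) (h : y ≠ z) :
    inducedUnit C W x y s * inducedUnit C W z t s' = 0 := by
  refine ContinuousLinearMap.ext fun f => ?_
  have h1 : ∀ ξ : W.V, (l2Incl y).adjoint (l2Incl z ξ) = 0 := fun ξ =>
    congrArg (fun T : W.V →L[ℂ] W.V => T ξ) (adjoint_l2Incl_comp_of_ne h)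
  change l2Incl x (W.π _ ((l2Incl y).adjoint (l2Incl z (W.π _ ((l2Incl t).adjoint f))))) = 0
  rw [h1, map_zero, map_zero]

theorem star_inducedUnit (x y : C.carrier) (s : Cent r C) : star (inducedUnit C W x y s) =
    ((((K.phiC (r C)).toFun s⁻¹ s)⁻¹ : Circle) : ℂ) • inducedUnit C W y x s⁻¹ := by
  rw [ContinuousLinearMap.star_eq_adjoint, inducedUnit, ContinuousLinearMap.adjoint_comp,
    ContinuousLinearMap.adjoint_comp, ContinuousLinearMap.adjoint_adjoint,
    ← ContinuousLinearMap.star_eq_adjoint (W.π _), ← map_star, star_basisElt, map_smul]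
  refine ContinuousLinearMap.ext fun f => ?_
  exact map_smul (l2Incl y) _ _

open Classical in
/-- The action of the basis of matrix units of the tube algebra on `ℓ²(C) ⊗ W`. -/
noncomputable def inducedBasis (i : UnitIndex r) : InducedSpace C W →L[ℂ] InducedSpace C W :=
  if h : i.1 = C then inducedUnit C W ⟨i.2.1.1, h ▸ i.2.1.1.2⟩ ⟨i.2.1.2, h ▸ i.2.1.2.2⟩
    ⟨i.2.2, h ▸ i.2.2.2⟩ else 0

theorem inducedBasis_self (x y : C.carrier) (s : Cent r C) :
    inducedBasis C W ⟨C, (x, y), s⟩ = inducedUnit C W x y s := dif_pos rfl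

theorem inducedBasis_of_ne {D : ConjClasses G} (h : D ≠ C) (p : (D.carrier × D.carrier) × Cent r D) :
    inducedBasis C W ⟨D, p⟩ = 0 := dif_neg h

/-- The action of the tube algebra on `ℓ²(C) ⊗ W`. -/
noncomputable def inducedMap : K.Tube →ₗ[ℂ] InducedSpace C W →L[ℂ] InducedSpace C W :=
  (K.tubeUnitBasis hr).constr ℂ (inducedBasis C W)

theorem inducedMap_tubeUnit (D : ConjClasses G) (x y : D.carrier) (s : Cent r D) :
    inducedMap hr C W (K.tubeUnit hr D x y s) = inducedBasis C W ⟨D, (x, y), s⟩ := by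
  have h := K.tubeUnitBasis_apply hr ⟨D, (x, y), s⟩
  rw [inducedMap, ← h, Module.Basis.constr_basis]

theorem inducedMap_mul (a b : K.Tube) :
    inducedMap hr C W (a * b) = inducedMap hr C W a * inducedMap hr C W b := by
  refine map_mul_of_basis (K.tubeUnitBasis hr) (inducedMap hr C W) ?_ a b
  rintro ⟨D, ⟨x, y⟩, s⟩ ⟨D', ⟨z, t⟩, s'⟩
  simp only [tubeUnitBasis_apply, inducedMap_tubeUnit]
  induction D, x, y, s, D', z, t, s' using tubeUnit_mul_tubeUnit_cases with
  | eq D x y z s t =>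
    rw [tubeUnit_mul, map_smul, inducedMap_tubeUnit]
    by_cases h : D = C
    · subst h
      simp only [inducedBasis_self, inducedUnit_mul]
    · simp only [inducedBasis_of_ne C W h, mul_zero, smul_zero]
  | ne D x y s D' z t s' hne =>
    rw [K.tubeUnit_mul_of_ne hr hne, map_zero]
    by_cases h : D = C
    · subst h
      by_cases h' : D' = D
      · subst h'
        rw [inducedBasis_self, inducedBasis_self, inducedUnit_mul_of_ne]
        exact fun h => hne (congrArg Subtype.val h)
      · rw [inducedBasis_of_ne _ W h', mul_zero]
    · rw [inducedBasis_of_ne C W h, zero_mul]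

theorem inducedMap_star (a : K.Tube) : inducedMap hr C W (star a) = star (inducedMap hr C W a) := by
  refine map_star_of_basis K.tube_star_add star_add (K.tubeUnitBasis hr) (inducedMap hr C W) ?_ a
  rintro ⟨D, ⟨x, y⟩, s⟩
  simp only [tubeUnitBasis_apply, star_tubeUnit, map_smul, inducedMap_tubeUnit]
  by_cases h : D = C
  · subst h
    simp only [inducedBasis_self, star_inducedUnit]
  · simp only [inducedBasis_of_ne C W h, star_zero, smul_zero]

theorem inducedMap_tubeUnit_l2Incl (x y : C.carrier) (s : Cent r C) (ξ : W.V) :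
    inducedMap hr C W (K.tubeUnit hr C x y s) (l2Incl y ξ) =
      l2Incl x (W.π (basisElt _ s) ξ) := by
  rw [inducedMap_tubeUnit, inducedBasis_self]
  change l2Incl x (W.π _ ((l2Incl y).adjoint (l2Incl y ξ))) = _
  rw [adjoint_l2Incl_apply]

/-- The representation of the tube algebra on `ℓ²(C) ⊗ W`. -/
noncomputable def inducedRep : HilbRep.{max u w} K.Tube where
  V := InducedSpace C W
  π :=
    { toFun := inducedMap hr C W
      map_smul' := map_smul _
      map_zero' := map_zero _
      map_add' := map_add _
      map_mul' := inducedMap_mul hr C W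
      map_star' := inducedMap_star hr C W }
  nondegenerate := by
    refine eq_top_of_l2Incl_mem (Submodule.isClosed_topologicalClosure _) fun x ξ =>
      Submodule.le_topologicalClosure _ (Submodule.subset_span
        ⟨K.tubeUnit hr C x x 1, l2Incl x ξ, ?_⟩)
    change inducedMap hr C W _ _ = _
    rw [inducedMap_tubeUnit_l2Incl, π_one_apply]

/-- The inclusion of `W` in `ℓ²(C) ⊗ W` at a point of `C`. -/
noncomputable def inducedIncl (x : C.carrier) : W.V →L[ℂ] (inducedRep hr C W).V := l2Incl x

theorem π_inducedIncl (x y : C.carrier) (s : Cent r C) (ξ : W.V) :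
    (inducedRep hr C W).π (K.tubeUnit hr C x y s) (inducedIncl hr C W y ξ) =
      inducedIncl hr C W x (W.π (basisElt _ s) ξ) := inducedMap_tubeUnit_l2Incl hr C W x y s ξ

theorem inducedRep_supportedOn : K.supportedOn (r C) (inducedRep hr C W) := by
  have h0 : ∀ ξ, inducedIncl hr C W (basePoint hr C) ξ ∈
      (inducedRep hr C W).generated (K.weightSpace (inducedRep hr C W) (r C)) := fun ξ => by
    refine subset_generated _ _ ?_
    rw [weightSpace_eq]
    refine ⟨inducedIncl hr C W (basePoint hr C) ξ, ?_⟩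
    have h := π_inducedIncl hr C W (basePoint hr C) (basePoint hr C) 1 ξ
    rwa [tubeUnit_one, π_one_apply] at h
  refine eq_top_of_l2Incl_mem (ι := C.carrier) (E := W.V)
    ((inducedRep hr C W).isSubmodule_generated _).1 fun x ξ => ?_
  have h := π_inducedIncl hr C W x (basePoint hr C) 1 ξ
  rw [π_one_apply] at h
  change inducedIncl hr C W x ξ ∈ _
  rw [← h]
  exact ((inducedRep hr C W).isSubmodule_generated _).2 _ _ (h0 ξ)

theorem tubeUnit_basePoint (s : Cent r C) :
    K.tubeUnit hr C (basePoint hr C) (basePoint hr C) s = K.cornerElt r C s := by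
  rw [tubeUnit, K.tubeIso_of_eq hr C _ rfl, star_arrow_one, ← cornerElt_one, cornerElt_mul,
    smul_mul_assoc, cornerElt_mul, (K.phiC (r C)).one_left, (K.phiC (r C)).one_right, one_mul,
    mul_one, Circle.coe_one, one_smul, one_smul]

theorem π_cornerMap_inducedIncl (a : TwistedGroupAlgebra (K.phiC (r C))) (ξ : W.V) :
    (inducedRep hr C W).π (K.cornerMap r C a) (inducedIncl hr C W (basePoint hr C) ξ) =
      inducedIncl hr C W (basePoint hr C) (W.π a ξ) := by
  induction a using basis_smul_induction (groupBasis (K.phiC (r C))) with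
  | zero =>
    rw [map_zero, map_zero, map_zero]
    exact (map_zero (inducedIncl hr C W (basePoint hr C))).symm
  | add a b ha hb =>
    rw [map_add, map_add, map_add, add_apply, add_apply, map_add, ha, hb]
  | basis s c =>
    rw [map_smul, map_smul, map_smul, smul_apply, smul_apply, map_smul, groupBasis_apply,
      cornerMap_basisElt, ← tubeUnit_basePoint hr, π_inducedIncl]

theorem inducedIncl_adjoint (ξ : (cornerRep r C (inducedRep hr C W)).V) :
    inducedIncl hr C W (basePoint hr C) ((inducedIncl hr C W (basePoint hr C)).adjoint
      (cornerIncl r C _ ξ)) = cornerIncl r C _ ξ := by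
  conv_rhs => rw [← π_cornerIncl, show K.arrow (r C) 1 = K.tubeUnit hr C (basePoint hr C) (basePoint hr C) 1 from
    (K.tubeUnit_one hr C (basePoint hr C)).symm]
  change _ = inducedMap hr C W (K.tubeUnit hr C (basePoint hr C) (basePoint hr C) 1) _
  rw [inducedMap_tubeUnit, inducedBasis_self]
  exact congrArg _ (π_one_apply W _).symm

/-- The space of the representative in the induced representation of `W` is `W`. -/
noncomputable def cornerInducedIso : cornerRep r C (inducedRep hr C W) ≅ W where
  hom := ⟨(inducedIncl hr C W (basePoint hr C)).adjoint ∘L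
    (cornerIncl r C (inducedRep hr C W)).toContinuousLinearMap, fun a ξ => by
      change (inducedIncl hr C W (basePoint hr C)).adjoint (cornerIncl r C _ _) =
        W.π a ((inducedIncl hr C W (basePoint hr C)).adjoint (cornerIncl r C _ ξ))
      rw [cornerIncl_π, ← inducedIncl_adjoint, π_cornerMap_inducedIncl]
      have h := fun η => adjoint_l2Incl_apply (E := W.V) (basePoint hr C) η
      exact (h _).trans (congrArg _ (h _).symm)⟩
  inv := ⟨(inducedIncl hr C W (basePoint hr C)).codRestrict
      (cornerSpace r C (inducedRep hr C W)) fun ξ => by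
        rw [mem_cornerSpace, ← cornerMap_one, π_cornerMap_inducedIncl, π_one_apply],
    fun a ξ => Subtype.ext (π_cornerMap_inducedIncl hr C W a ξ).symm⟩
  hom_inv_id := HilbRep.Hom.ext (ContinuousLinearMap.ext fun ξ =>
    Subtype.ext (inducedIncl_adjoint hr C W ξ))
  inv_hom_id := HilbRep.Hom.ext (ContinuousLinearMap.ext fun ξ => adjoint_l2Incl_apply _ ξ)

theorem essSurj_cornerFunctor (hr : ∀ C, ConjClasses.mk (r C) = C) (C : ConjClasses G) :
    (cornerFunctor.{max u w} (K := K) r C).EssSurj where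
  mem_essImage W := ⟨⟨inducedRep hr C W, inducedRep_supportedOn hr C W⟩,
    ⟨cornerInducedIso hr C W⟩⟩

end GKernel

theorem theorem3p1 {H : Type v} [NormedAddCommGroup H] [InnerProductSpace ℂ H] [CompleteSpace H]
    (M : II1Factor H) {G : Type u} [Group G] (K : GKernel M G)
    (r : ConjClasses G → G) (hr : ∀ C, ConjClasses.mk (r C) = C) :
    Nonempty (K.Tube ≃⋆ₐ[ℂ] K.ClassAlgebra r) ∧
    (∀ X : HilbRep.{w} K.Tube,
      K.IsClassDecomposition r X (fun C => X.generated (K.weightSpace X (r C))) ∧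
      ∀ W, K.IsClassDecomposition r X W → ∀ C, W C = X.generated (K.weightSpace X (r C))) ∧
    ∀ C : ConjClasses G,
      ∃ e : (GKernel.supportedOn.{max u w} K (r C)).FullSubcategory ≌
          HilbRep.{max u w} (TwistedGroupAlgebra (K.phiC (r C))),
        e.functor.Additive ∧ e.functor.Linear ℂ := by
  refine ⟨K.nonempty_starAlgEquiv hr, fun X => ⟨GKernel.isClassDecomposition_generated X hr,
    fun W hW C => hW.eq_generated X hr C⟩, fun C => ?_⟩
  have := GKernel.full_cornerFunctor.{max u w} (K := K) hr C
  have := GKernel.essSurj_cornerFunctor.{u, v, w} (K := K) hr C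
  have : (GKernel.cornerFunctor.{max u w} (K := K) r C).IsEquivalence := {}
  exact ⟨(GKernel.cornerFunctor.{max u w} (K := K) r C).asEquivalence,
    inferInstanceAs (GKernel.cornerFunctor r C).Additive,
    inferInstanceAs ((GKernel.cornerFunctor r C).Linear ℂ)⟩
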